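/- Graphs are finite and may have loops and parallel edges. For a graph $G$ with edge set $E$, let $V_{\mathcal M(G)}=\{\mathbf 1_B : B\subseteq E \text{ a spanning forest of } G\}\subset\mathbb R^{E}$, where a spanning forest is an inclusion-maximal set of edges containing no cycle (a basis of the graphic matroid $\mathcal M(G)$) and $\mathbf 1_B$ is its characteristic vector. A face of a finite set $V\subset\mathbb R^{E}$ is a set $\{v\in V:\ell(v)=0\}$ with $\ell$ an affine function that is non-negative on $V$; $\ell$ is facet-defining if its face is inclusion-maximal among the faces different from $V$. The graph $G$ is called $k$-level if every facet-defining affine function for $V_{\mathcal M(G)}$ takes at most $k$ distinct values on $V_{\mathcal M(G)}$. A graph is biconnected if it is non-empty, connected and has no vertex whose removal disconnects it (so $K_2$ is biconnected); it is minimally biconnected if it is biconnected and the deletion of any edge yields a graph that is not biconnected. The cone $\mathrm{cone}(H)$ over a graph $H$ is obtained from $H$ by adding a new vertex $w$ and one edge from $w$ to each vertex of $H$. A minor of $G$ is a graph isomorphic to one obtained from $G$ by deleting vertices and edges and contracting edges. Theorem. Let $k\ge 1$ be an integer and let $G$ be a graph; if $k=1$, assume in addition that no two distinct vertices of $G$ are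 joined by more than one edge. Then $G$ is $k$-level if and only if $G$ has no minor $\mathrm{cone}(H)$ where $H$ is a minimally biconnected graph on $k+1$ vertices. -/

import Mathlib

open scoped Graph

/-! ### Point configurations and levels -/

section PointConfiguration

variable {W : Type*} [AddCommGroup W] [Module ℝ W]

/-- The face of the point configuration `P` cut out by the affine function `l`
(meant for `l` non-negative on `P`). -/
def zeroFace (P : Set W) (l : W →ᵃ[ℝ] ℝ) : Set W := {v ∈ P | l v = 0}

/-- `l` is non-negative on `P` and does not vanish identically on `P`, so that it cuts out a
proper face of `P`. -/
def IsProperSupporting (P : Set W) (l : W →ᵃ[ℝ] ℝ) : Prop :=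
  (∀ v ∈ P, 0 ≤ l v) ∧ zeroFace P l ≠ P

/-- `l` is facet-defining for `P`: its face is inclusion-maximal among the proper faces. -/
def IsFacetDefining (P : Set W) (l : W →ᵃ[ℝ] ℝ) : Prop :=
  IsProperSupporting P l ∧
    ∀ l' : W →ᵃ[ℝ] ℝ, IsProperSupporting P l' →
      zeroFace P l ⊆ zeroFace P l' → zeroFace P l' = zeroFace P l

/-- `P` is `k`-level: every facet-defining affine function takes at most `k` distinct values
on `P`. -/
def IsKLevelConfiguration (P : Set W) (k : ℕ) : Prop :=
  ∀ l : W →ᵃ[ℝ] ℝ, IsFacetDefining P l → (l '' P).encard ≤ k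

end PointConfiguration

/-! ### Multigraphs (loops and parallel edges are allowed) -/

namespace Graph

variable {α β α' β' : Type*}

/-- The vertices `v 0, …, v n` and edges `e 0, …, e n` form a cycle of length `n + 1` in `G`.
The case `n = 0` is a loop and the case `n = 1` a pair of parallel edges. -/
def IsCycle (G : Graph α β) (n : ℕ) (v : Fin (n + 1) → α) (e : Fin (n + 1) → β) : Prop :=
  Function.Injective v ∧ Function.Injective e ∧ ∀ i, G.IsLink (e i) (v i) (v (i + 1))

/-- A set of edges of `G` that contains no cycle. -/
def IsForest (G : Graph α β) (B : Set β) : Prop :=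
  B ⊆ E(G) ∧ ∀ n v e, G.IsCycle n v e → ¬ Set.range e ⊆ B

/-- A spanning forest is an inclusion-maximal forest, that is, a basis of the graphic matroid
of `G`. -/
def IsSpanningForest (G : Graph α β) (B : Set β) : Prop :=
  Maximal G.IsForest B

/-- The characteristic vector in `ℝ^E` of a set of edges. -/
noncomputable def charVec (G : Graph α β) (B : Set β) : E(G) → ℝ :=
  fun e => B.indicator 1 (e : β)

/-- The base configuration of the graphic matroid of `G`: the characteristic vectors of the
spanning forests. -/
def baseConfiguration (G : Graph α β) : Set (E(G) → ℝ) :=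
  {x | ∃ B, G.IsSpanningForest B ∧ x = G.charVec B}

/-- `G` is `k`-level if the base configuration of its graphic matroid is. -/
def IsKLevel (G : Graph α β) (k : ℕ) : Prop :=
  IsKLevelConfiguration G.baseConfiguration k

/-- Any two vertices are joined by a walk (the graph may have no vertex). -/
def IsPreconnected (G : Graph α β) : Prop :=
  ∀ x ∈ V(G), ∀ y ∈ V(G), Relation.ReflTransGen G.Adj x y

/-- Connected and with at least one vertex. -/
def IsConnected (G : Graph α β) : Prop :=
  V(G).Nonempty ∧ G.IsPreconnected

/-- Connected and without cut vertex; a single edge with its two ends is biconnected. -/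
def IsBiconnected (G : Graph α β) : Prop :=
  G.IsConnected ∧ ∀ v ∈ V(G), (G.deleteVerts {v}).IsPreconnected

/-- Biconnected, but the deletion of any edge destroys this. -/
def IsMinimallyBiconnected (G : Graph α β) : Prop :=
  G.IsBiconnected ∧ ∀ e ∈ E(G), ¬ (G.deleteEdges {e}).IsBiconnected

/-- The cone over `H`. The apex is `none`; the edge `Sum.inr x` joins the vertex `x` of `H`
to the apex. -/
def cone (H : Graph α β) : Graph (Option α) (β ⊕ α) where
  vertexSet := insert none (some '' V(H))
  IsLink e p q :=
    match e with
    | Sum.inl f => ∃ x y, H.IsLink f x y ∧ p = some x ∧ q = some y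
    | Sum.inr x => x ∈ V(H) ∧ ((p = some x ∧ q = none) ∨ (p = none ∧ q = some x))
  isLink_symm := by
    rintro (f | x) -
    · exact ⟨fun p q ⟨x, y, h, hp, hq⟩ => ⟨y, x, h.symm, hq, hp⟩⟩
    · exact ⟨fun p q ⟨hx, h⟩ => ⟨hx, h.symm.imp And.symm And.symm⟩⟩
  eq_or_eq_of_isLink_of_isLink := by
    rintro (f | x) p q r s h h'
    · obtain ⟨x, y, h, rfl, rfl⟩ := h
      obtain ⟨z, w, h', rfl, rfl⟩ := h'
      simpa using H.eq_or_eq_of_isLink_of_isLink h h'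
    · obtain ⟨-, h⟩ := h
      obtain ⟨-, h'⟩ := h'
      aesop
  left_mem_of_isLink := by
    rintro (f | x) p q h
    · obtain ⟨x, y, h, rfl, rfl⟩ := h
      exact Or.inr ⟨x, h.left_mem, rfl⟩
    · obtain ⟨hx, ⟨rfl, rfl⟩ | ⟨rfl, rfl⟩⟩ := h
      · exact Or.inr ⟨x, hx, rfl⟩
      · exact Or.inl rfl

/-- `N` is (isomorphic to) a minor of `G`: there are pairwise vertex-disjoint connected subgraphs
`T x` of `G`, one for each vertex `x` of `N`, and distinct further edges `φ e` of `G`, one for each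
edge `e` of `N`, such that `φ e` joins `T x` to `T y` whenever `e` joins `x` to `y`. Contracting
each `T x` to a vertex and deleting what is not used turns `G` into a copy of `N`. -/
def IsMinorOf (N : Graph α' β') (G : Graph α β) : Prop :=
  ∃ (T : α' → Graph α β) (φ : β' → β),
    (∀ x ∈ V(N), T x ≤ G ∧ (T x).IsConnected) ∧
    (∀ x ∈ V(N), ∀ y ∈ V(N), x ≠ y → Disjoint V(T x) V(T y)) ∧
    Set.InjOn φ E(N) ∧
    (∀ e ∈ E(N), ∀ x ∈ V(N), φ e ∉ E(T x)) ∧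
    (∀ e x y, N.IsLink e x y → ∃ u ∈ V(T x), ∃ v ∈ V(T y), G.IsLink (φ e) u v)

/-- Any two distinct vertices are joined by at most one edge. -/
def HasNoParallelEdges (G : Graph α β) : Prop :=
  ∀ e f x y, x ≠ y → G.IsLink e x y → G.IsLink f x y → e = f

end Graph

/-! On spanning forests an affine function is a constant plus a sum of edge weights, and facets are
understood through the counts |B ∩ F|. If such a count is not constant and is minimal on all forests
of a facet, it is an increasing affine function of the facet-defining function, so both take equally
many values (`IsFacetDefining.encard_image_eq_ncard`).

A cone minor gives many values. A fixed edge set C turns all spanning trees of the cone over H into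
spanning forests of G (`exists_lift_isSpanningForest`). With F consisting of C and the edges of H,
the count |B ∩ F| is maximal on the lifts with a single apex edge. Take a facet containing all these
lifts but not the lift of the star at the apex. Exchanging edges shows that its function equals s(k
- j), with s ≠ 0, on each lifted tree with j edges in H (`IsMinimallyBiconnected.exists_eq_mul`).
All j from 0 to k occur, which makes k + 1 values.

Conversely, let k ≥ 2 and let l define a facet with more than k values. Take F minimal such that |B
∩ F| is maximal on the forests of the facet and not constant. Minimality makes the set U of ends of
F biconnected (`connOn_endSet_sdiff_of_minimal`), and every forest of the facet contains a tree on U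
within F. Such a forest uses no other edge inside U, and as few edges as possible at any set W
closed outside U (`IsClosedOutside.ncard_inter_le`). Hence l either has the two values of an edge
coordinate, or as many values as the number of forest edges at some connected W. The latter are at
most as many as the vertices of U adjacent to W, or one (`IsClosedOutside.encard_image_le`). So W
has at least k + 1 neighbours in U. Contracting U to k + 1 vertices while keeping it biconnected
(`BiconnOn.exists_contraction`), and W to the apex, gives the cone.

For k = 1, an edge in one spanning forest but not in another closes a cycle, which has length at
least three without parallel edges. -/

namespace Graph

variable {α β : Type*} {G : Graph α β} {X Y B I J : Set β} {Z R : Set α} {x y z a b : α} {e f : β}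

/-! ### Walks inside a set of edges -/

/-- `x` and `y` are joined by a walk all of whose edges lie in `X`. -/
def EdgeConn (G : Graph α β) (X : Set β) : α → α → Prop :=
  Relation.ReflTransGen fun a b => ∃ e ∈ X, G.IsLink e a b

namespace EdgeConn

lemma refl (x : α) : G.EdgeConn X x x := Relation.ReflTransGen.refl

lemma of_isLink (he : e ∈ X) (h : G.IsLink e x y) : G.EdgeConn X x y :=
  Relation.ReflTransGen.single ⟨e, he, h⟩

lemma trans (h : G.EdgeConn X x y) (h' : G.EdgeConn X y z) : G.EdgeConn X x z :=
  Relation.ReflTransGen.trans h h'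

lemma tail (h : G.EdgeConn X x y) (he : e ∈ X) (h' : G.IsLink e y z) : G.EdgeConn X x z :=
  h.trans (of_isLink he h')

lemma symm (h : G.EdgeConn X x y) : G.EdgeConn X y x := by
  induction h with
  | refl => exact refl _
  | tail _ h ih =>
    obtain ⟨e, he, h⟩ := h
    exact (of_isLink he h.symm).trans ih

lemma bind (h : G.EdgeConn X x y)
    (hXY : ∀ e ∈ X, ∀ a b, G.IsLink e a b → G.EdgeConn Y a b) : G.EdgeConn Y x y := by
  induction h with
  | refl => exact refl _
  | tail _ h ih =>
    obtain ⟨e, he, h⟩ := h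
    exact ih.trans (hXY e he _ _ h)

lemma mono (hXY : X ⊆ Y) (h : G.EdgeConn X x y) : G.EdgeConn Y x y :=
  h.bind fun _ he _ _ h => of_isLink (hXY he) h

lemma mem_of_closed {S : Set α} (h : G.EdgeConn X x y) (hx : x ∈ S)
    (hS : ∀ e ∈ X, ∀ a b, G.IsLink e a b → a ∈ S → b ∈ S) : y ∈ S := by
  induction h with
  | refl => exact hx
  | tail _ h ih =>
    obtain ⟨e, he, h⟩ := h
    exact hS e he _ _ h ih

lemma of_insert (he : G.IsLink e x y) (h : G.EdgeConn (insert e X) a b) :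
    G.EdgeConn X a b ∨ (G.EdgeConn X a x ∧ G.EdgeConn X y b) ∨
      (G.EdgeConn X a y ∧ G.EdgeConn X x b) := by
  induction h with
  | refl => exact Or.inl (refl _)
  | @tail c d _ h ih =>
    obtain ⟨f, rfl | hf, h⟩ := h
    · obtain ⟨rfl, rfl⟩ | ⟨rfl, rfl⟩ := he.eq_and_eq_or_eq_and_eq h
      · obtain h1 | ⟨h1, h2⟩ | ⟨h1, h2⟩ := ih
        · exact Or.inr (Or.inl ⟨h1, refl _⟩)
        · exact Or.inr (Or.inl ⟨h1, refl _⟩)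
        · exact Or.inl h1
      · obtain h1 | ⟨h1, h2⟩ | ⟨h1, h2⟩ := ih
        · exact Or.inr (Or.inr ⟨h1, refl _⟩)
        · exact Or.inl h1
        · exact Or.inr (Or.inr ⟨h1, refl _⟩)
    · obtain h1 | ⟨h1, h2⟩ | ⟨h1, h2⟩ := ih
      · exact Or.inl (h1.tail hf h)
      · exact Or.inr (Or.inl ⟨h1, h2.tail hf h⟩)
      · exact Or.inr (Or.inr ⟨h1, h2.tail hf h⟩)

end EdgeConn

/-! ### Forests -/

/-- The edge e closes a path in X. Distinct vertices along the path come from a path in the simple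
graph underlying X; if x = y, the edge is itself a loop. -/
lemma exists_isCycle_of_edgeConn (he : G.IsLink e x y) (heX : e ∉ X) (h : G.EdgeConn X x y) :
    ∃ n v c, G.IsCycle n v c ∧ Set.range c ⊆ insert e X := by
  classical
  obtain rfl | hxy := eq_or_ne x y
  · refine ⟨0, fun _ => x, fun _ => e, ⟨?_, ?_, fun _ => he⟩, ?_⟩
    · exact fun i j _ => Subsingleton.elim (α := Fin 1) i j
    · exact fun i j _ => Subsingleton.elim (α := Fin 1) i j
    · rintro _ ⟨i, rfl⟩
      exact Or.inl rfl
  let S : SimpleGraph α := SimpleGraph.fromRel fun a b => ∃ e ∈ X, G.IsLink e a b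
  have hS : S.Reachable x y := by
    clear he hxy
    induction h with
    | refl => rfl
    | @tail c d _ h ih =>
      obtain rfl | hcd := eq_or_ne c d
      · exact ih
      · exact ih.trans (SimpleGraph.Adj.reachable
          ((SimpleGraph.fromRel_adj _ _ _).2 ⟨hcd, Or.inl h⟩))
  obtain ⟨p, hp⟩ := hS.exists_isPath
  have hadj : ∀ i < p.length, ∃ f ∈ X, G.IsLink f (p.getVert i) (p.getVert (i + 1)) := by
    intro i hi
    obtain ⟨-, h | ⟨f, hf, h⟩⟩ := (SimpleGraph.fromRel_adj _ _ _).1 (p.adj_getVert_succ hi)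
    · exact h
    · exact ⟨f, hf, h.symm⟩
  choose c hcX hc using hadj
  have hinj := hp.getVert_injOn
  have key : ∀ i (hi : i < p.length) j (hj : j < p.length), c i hi = c j hj → i = j := by
    intro i hi j hj hij
    have h1 := hc i hi
    rw [hij] at h1
    obtain ⟨h2, h3⟩ | ⟨h2, h3⟩ := h1.eq_and_eq_or_eq_and_eq (hc j hj)
    · exact hinj (by simp; omega) (by simp; omega) h2
    · have := hinj (by simp; omega) (by simp; omega) h2
      have := hinj (by simp; omega) (by simp; omega) h3
      omega
  refine ⟨p.length, fun i => p.getVert i, fun i => if hi : (i : ℕ) < p.length then c i hi else e,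
    ⟨?_, ?_, ?_⟩, ?_⟩
  · intro i j hij
    exact Fin.ext (hinj (by simp; omega) (by simp; omega) hij)
  · intro i j hij
    by_cases hi : (i : ℕ) < p.length <;> by_cases hj : (j : ℕ) < p.length <;>
      simp only [hi, hj, dif_pos, dif_neg, not_false_iff] at hij
    · exact Fin.ext (key _ hi _ hj hij)
    · exact absurd (hij ▸ hcX _ hi) heX
    · exact absurd (hij ▸ hcX _ hj) heX
    · ext; omega
  · intro i
    by_cases hi : (i : ℕ) < p.length
    · have : ((i + 1 : Fin (p.length + 1)) : ℕ) = i + 1 :=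
        Fin.val_add_one_of_lt (by rw [Fin.lt_def]; simpa using hi)
      simp only [hi, dif_pos, this]
      exact hc _ hi
    · have h1 : i = Fin.last _ := by ext; simp; omega
      subst h1
      simpa using he.symm
  · rintro _ ⟨i, rfl⟩
    by_cases hi : (i : ℕ) < p.length
    · simp only [hi, dif_pos]
      exact Or.inr (hcX _ hi)
    · simp [hi]

/-- A forest is a set in which every edge is a bridge. This form replaces indexed cycles in all
later arguments. -/
lemma isForest_iff : G.IsForest B ↔
    B ⊆ E(G) ∧ ∀ e ∈ B, ∀ x y, G.IsLink e x y → ¬ G.EdgeConn (B \ {e}) x y := by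
  refine and_congr_right fun hB => ⟨fun h e he x y hl hc => ?_, fun h n v c hc hB => ?_⟩
  · obtain ⟨n, v, c, hcyc, hsub⟩ := exists_isCycle_of_edgeConn hl (by simp) hc
    refine h n v c hcyc (hsub.trans ?_)
    rintro f (rfl | hf)
    exacts [he, hf.1]
  · obtain ⟨hv, hinj, hl⟩ := hc
    have hlast := hl (Fin.last n)
    rw [Fin.last_add_one] at hlast
    refine h _ (hB ⟨Fin.last n, rfl⟩) _ _ hlast.symm ?_
    have : ∀ i : ℕ, ∀ hi : i < n + 1, G.EdgeConn (B \ {c (Fin.last n)}) (v 0) (v ⟨i, hi⟩) := by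
      intro i
      induction i with
      | zero => exact fun _ => EdgeConn.refl _
      | succ i ih =>
        intro hi
        have h1 := hl ⟨i, by omega⟩
        have h2 : (⟨i, by omega⟩ + 1 : Fin (n + 1)) = ⟨i + 1, hi⟩ := by
          ext
          rw [Fin.val_add_one_of_lt]
          rw [Fin.lt_def]; simp; omega
        rw [h2] at h1
        refine (ih (by omega)).tail ⟨hB ⟨_, rfl⟩, fun h => ?_⟩ h1
        have := congrArg Fin.val (hinj h)
        simp at this
        omega
    exact this n (by omega)

namespace IsForest

lemma not_edgeConn (hB : G.IsForest B) (he : e ∈ B) (h : G.IsLink e x y) :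
    ¬ G.EdgeConn (B \ {e}) x y :=
  (isForest_iff.1 hB).2 e he x y h

lemma subset (hB : G.IsForest B) (h : I ⊆ B) : G.IsForest I :=
  ⟨h.trans hB.1, fun n v c hc hI => hB.2 n v c hc (hI.trans h)⟩

lemma empty : G.IsForest ∅ :=
  isForest_iff.2 ⟨Set.empty_subset _, fun _ h => absurd h (Set.notMem_empty _)⟩

lemma insert_edge (hB : G.IsForest B) (he : G.IsLink e x y) (h : ¬ G.EdgeConn B x y) :
    G.IsForest (insert e B) := by
  have heB : e ∉ B := fun heB => h (EdgeConn.of_isLink heB he)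
  refine isForest_iff.2 ⟨Set.insert_subset he.edge_mem hB.1, ?_⟩
  rintro f (rfl | hf) a b hl hc
  · rw [Set.insert_sdiff_self_of_notMem heB] at hc
    obtain ⟨rfl, rfl⟩ | ⟨rfl, rfl⟩ := he.eq_and_eq_or_eq_and_eq hl
    exacts [h hc, h hc.symm]
  · have hne : e ≠ f := fun h => heB (h ▸ hf)
    rw [Set.insert_sdiff_of_notMem _ (by simpa using hne)] at hc
    have hle : B \ {f} ⊆ B := Set.sdiff_subset
    obtain h1 | ⟨h1, h2⟩ | ⟨h1, h2⟩ := hc.of_insert he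
    · exact hB.not_edgeConn hf hl h1
    · exact h (((h1.mono hle).symm.tail hf hl).trans (h2.mono hle).symm)
    · exact h (((h2.mono hle).tail hf hl.symm).trans (h1.mono hle))

lemma ne_of_isLink (hB : G.IsForest B) (he : e ∈ B) (h : G.IsLink e x y) : x ≠ y := by
  rintro rfl
  exact hB.not_edgeConn he h (EdgeConn.refl _)

/-- A forest in `X` extends to a forest in `X` with the same components as `X`. -/
lemma exists_maximal (hI : G.IsForest I) (hIX : I ⊆ X) (hX : X ⊆ E(G)) (hfin : E(G).Finite) :
    ∃ J, I ⊆ J ∧ J ⊆ X ∧ G.IsForest J ∧ ∀ x y, G.EdgeConn X x y → G.EdgeConn J x y := by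
  have hf : {J | I ⊆ J ∧ J ⊆ X ∧ G.IsForest J}.Finite :=
    (hfin.finite_subsets).subset fun J hJ => hJ.2.1.trans hX
  obtain ⟨J, hJ⟩ := hf.exists_maximal ⟨I, subset_rfl, hIX, hI⟩
  refine ⟨J, hJ.prop.1, hJ.prop.2.1, hJ.prop.2.2, fun x y h => h.bind fun e he a b hl => ?_⟩
  by_contra hc
  have h1 := hJ.le_of_ge (y := insert e J) ⟨hJ.prop.1.trans (Set.subset_insert _ _),
    Set.insert_subset he hJ.prop.2.1, hJ.prop.2.2.insert_edge hl hc⟩ (Set.subset_insert _ _)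
  exact hc (EdgeConn.of_isLink (h1 (Set.mem_insert _ _)) hl)

end IsForest

/-! ### Counting edges of forests -/

/-- `R` contains exactly one vertex of each class of vertices of `Z` joined through `X`. -/
def IsTransversal (G : Graph α β) (X : Set β) (Z R : Set α) : Prop :=
  R ⊆ Z ∧ (∀ z ∈ Z, ∃ r ∈ R, G.EdgeConn X z r) ∧
    ∀ r ∈ R, ∀ r' ∈ R, G.EdgeConn X r r' → r = r'

lemma exists_isTransversal_subset {N : Set α} (hN : N.Finite) (hNZ : N ⊆ Z)
    (h : ∀ z ∈ Z, ∃ r ∈ N, G.EdgeConn X z r) : ∃ R ⊆ N, G.IsTransversal X Z R := by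
  have hf : {R | R ⊆ N ∧ ∀ z ∈ Z, ∃ r ∈ R, G.EdgeConn X z r}.Finite :=
    hN.finite_subsets.subset fun R hR => hR.1
  obtain ⟨R, hR⟩ := hf.exists_minimal ⟨N, subset_rfl, h⟩
  refine ⟨R, hR.prop.1, hR.prop.1.trans hNZ, hR.prop.2, fun r hr r' hr' hrr => ?_⟩
  by_contra hne
  have h1 := hR.le_of_le (y := R \ {r}) ⟨Set.sdiff_subset.trans hR.prop.1, fun z hz => ?_⟩
    Set.sdiff_subset
  · exact (h1 hr).2 rfl
  · obtain ⟨s, hs, hzs⟩ := hR.prop.2 z hz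
    obtain rfl | hsr := eq_or_ne s r
    · exact ⟨r', ⟨hr', fun h => hne h.symm⟩, hzs.trans hrr⟩
    · exact ⟨s, ⟨hs, hsr⟩, hzs⟩

/-- Each added edge merges two classes. Since Z is any finite vertex set containing the ends of B,
the count applies to parts of G as well as to the whole graph. -/
lemma IsForest.ncard_add_ncard (hB : G.IsForest B) (hBfin : B.Finite) (hZ : Z.Finite)
    (hBZ : ∀ e ∈ B, ∀ x y, G.IsLink e x y → x ∈ Z) (hR : G.IsTransversal B Z R) :
    B.ncard + R.ncard = Z.ncard := by
  induction B, hBfin using Set.Finite.induction_on generalizing R with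
  | empty =>
    have : R = Z := by
      refine hR.1.antisymm fun z hz => ?_
      obtain ⟨r, hr, h⟩ := hR.2.1 z hz
      have : r ∈ ({z} : Set α) := h.mem_of_closed rfl (by simp)
      rwa [← Set.mem_singleton_iff.1 this]
    simp [this]
  | @insert e B heB hBfin ih =>
    obtain ⟨x, y, hl⟩ := exists_isLink_of_mem_edgeSet (hB.1 (Set.mem_insert e B))
    have hxy := hB.not_edgeConn (Set.mem_insert e B) hl
    rw [Set.insert_sdiff_self_of_notMem heB] at hxy
    have hsub : B ⊆ insert e B := Set.subset_insert _ _
    have hxZ := hBZ e (Set.mem_insert _ _) x y hl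
    obtain ⟨r, hr, hxr⟩ := hR.2.1 x hxZ
    -- Without e the representative r stays on the side of x or of y. By symmetry it is the side of
    -- x, and y becomes the representative of the class split off.
    wlog hxr' : G.EdgeConn B x r generalizing x y
    · refine this y x hl.symm (fun h => hxy h.symm) (hBZ e (Set.mem_insert _ _) y x hl.symm)
        ((EdgeConn.of_isLink (Set.mem_insert _ _) hl.symm).trans hxr) ?_
      obtain h1 | ⟨h1, h2⟩ | ⟨h1, h2⟩ := hxr.of_insert hl
      exacts [absurd h1 hxr', h2, absurd h1 hxy]
    have hyr : ∀ s ∈ R, ¬ G.EdgeConn B y s := by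
      intro s hs h
      have : s = r := hR.2.2 s hs r hr
        (((h.mono hsub).symm.tail (Set.mem_insert _ _) hl.symm).trans hxr)
      exact hxy (hxr'.trans (this ▸ h).symm)
    have hyR : y ∉ R := fun h => hyr y h (EdgeConn.refl _)
    have hR' : G.IsTransversal B Z (insert y R) := by
      refine ⟨Set.insert_subset (hBZ e (Set.mem_insert _ _) y x hl.symm) hR.1, fun z hz => ?_, ?_⟩
      · obtain ⟨s, hs, hzs⟩ := hR.2.1 z hz
        obtain h1 | ⟨h1, h2⟩ | ⟨h1, h2⟩ := hzs.of_insert hl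
        · exact ⟨s, Or.inr hs, h1⟩
        · exact absurd h2 (hyr s hs)
        · exact ⟨y, Or.inl rfl, h1⟩
      · rintro s (rfl | hs) t (rfl | ht) hst
        · rfl
        · exact absurd hst (hyr t ht)
        · exact absurd hst.symm (hyr s hs)
        · exact hR.2.2 s hs t ht (hst.mono hsub)
    have h1 := ih (hB.subset hsub) (fun f hf => hBZ f (hsub hf)) hR'
    have hRfin : R.Finite := hZ.subset hR.1
    rw [Set.ncard_insert_of_notMem hyR hRfin] at h1
    rw [Set.ncard_insert_of_notMem heB hBfin]
    omega

lemma IsForest.finite (hB : G.IsForest B) (hE : E(G).Finite) : B.Finite := hE.subset hB.1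

/-- The classes of I are unions of classes of J, so I has no more classes and therefore no fewer
edges. -/
lemma IsForest.ncard_le_ncard (hI : G.IsForest I) (hJ : G.IsForest J) (hV : V(G).Finite)
    (hE : E(G).Finite) (h : ∀ e ∈ J, ∀ x y, G.IsLink e x y → G.EdgeConn I x y) :
    J.ncard ≤ I.ncard := by
  obtain ⟨R, -, hR⟩ := exists_isTransversal_subset (G := G) (X := J) hV subset_rfl
    fun z hz => ⟨z, hz, EdgeConn.refl _⟩
  have hmeet : ∀ z ∈ V(G), ∃ r ∈ R, G.EdgeConn I z r := fun z hz => by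
    obtain ⟨r, hr, hzr⟩ := hR.2.1 z hz
    exact ⟨r, hr, hzr.bind h⟩
  obtain ⟨R', hR'R, hR'⟩ := exists_isTransversal_subset (hV.subset hR.1) hR.1 hmeet
  have h1 := hJ.ncard_add_ncard (hJ.finite hE) hV (fun e _ x y hl => hl.left_mem) hR
  have h2 := hI.ncard_add_ncard (hI.finite hE) hV (fun e _ x y hl => hl.left_mem) hR'
  have := Set.ncard_le_ncard hR'R (hV.subset hR.1)
  omega

/-! ### Spanning forests -/

/-- The components of `X` are the components of the graph. -/
def IsSpanning (G : Graph α β) (X : Set β) : Prop :=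
  ∀ e x y, G.IsLink e x y → G.EdgeConn X x y

lemma IsSpanningForest.isSpanning (hB : G.IsSpanningForest B) : G.IsSpanning B := by
  intro e x y hl
  by_contra hc
  have := hB.le_of_ge (hB.prop.insert_edge hl hc) (Set.subset_insert _ _)
  exact hc (EdgeConn.of_isLink (this (Set.mem_insert _ _)) hl)

lemma IsForest.isSpanningForest (hB : G.IsForest B) (h : G.IsSpanning B) :
    G.IsSpanningForest B := by
  refine ⟨hB, fun J hJ hBJ e he => ?_⟩
  by_contra heB
  obtain ⟨x, y, hl⟩ := exists_isLink_of_mem_edgeSet (hJ.1 he)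
  exact hJ.not_edgeConn he hl ((h e x y hl).mono fun f hf => ⟨hBJ hf, fun h => heB (h ▸ hf)⟩)

lemma IsSpanningForest.ncard_eq (hI : G.IsSpanningForest I) (hJ : G.IsSpanningForest J)
    (hV : V(G).Finite) (hE : E(G).Finite) : I.ncard = J.ncard :=
  le_antisymm (hJ.prop.ncard_le_ncard hI.prop hV hE fun e _ => hJ.isSpanning e)
    (hI.prop.ncard_le_ncard hJ.prop hV hE fun e _ => hI.isSpanning e)

lemma IsForest.exists_isSpanningForest_of_subset (hI : G.IsForest I) (hIX : I ⊆ X)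
    (hX : G.IsSpanning X) (hXE : X ⊆ E(G)) (hE : E(G).Finite) :
    ∃ J, I ⊆ J ∧ J ⊆ X ∧ G.IsSpanningForest J := by
  obtain ⟨J, hIJ, hJX, hJ, h⟩ := hI.exists_maximal hIX hXE hE
  exact ⟨J, hIJ, hJX, hJ.isSpanningForest fun e x y hl => h _ _ (hX e x y hl)⟩

lemma IsForest.exists_isSpanningForest (hI : G.IsForest I) (hE : E(G).Finite) :
    ∃ J, I ⊆ J ∧ G.IsSpanningForest J := by
  obtain ⟨J, h, -, h'⟩ := hI.exists_isSpanningForest_of_subset hI.1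
    (fun e x y hl => EdgeConn.of_isLink hl.edge_mem hl) subset_rfl hE
  exact ⟨J, h, h'⟩

lemma IsSpanning.isSpanningForest (hX : G.IsSpanning X) (hXE : X ⊆ E(G)) (hV : V(G).Finite)
    (hE : E(G).Finite) (hB : G.IsSpanningForest B) (h : X.ncard ≤ B.ncard) :
    G.IsSpanningForest X := by
  obtain ⟨J, -, hJX, hJ⟩ := (IsForest.empty (G := G)).exists_isSpanningForest_of_subset
    (Set.empty_subset X) hX hXE hE
  have := Set.eq_of_subset_of_ncard_le hJX (by rwa [hJ.ncard_eq hB hV hE]) (hE.subset hXE)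
  exact this ▸ hJ

end Graph

/-! ### Facets of finite point configurations -/

section PointConfiguration

variable {W : Type*} [AddCommGroup W] [Module ℝ W] {P : Set W} {l l' : W →ᵃ[ℝ] ℝ}

lemma isProperSupporting_of_pos (h : ∀ v ∈ P, 0 ≤ l v) {v : W} (hv : v ∈ P) (hlv : l v ≠ 0) :
    IsProperSupporting P l :=
  ⟨h, fun h' => hlv (h'.ge hv).2⟩

lemma IsProperSupporting.exists_pos (h : IsProperSupporting P l) : ∃ v ∈ P, 0 < l v := by
  by_contra! hc
  exact h.2 (Set.Subset.antisymm (fun v hv => hv.1) fun v hv => ⟨hv, (hc v hv).antisymm (h.1 v hv)⟩)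

/-- Subtract from a non-negative function the largest possible multiple of another one. -/
lemma exists_sub_smul_nonneg (hP : P.Finite) (h : ∀ v ∈ P, 0 ≤ l v)
    (hl' : IsProperSupporting P l') :
    ∃ t : ℝ, 0 ≤ t ∧ (∀ v ∈ P, 0 ≤ l v - t * l' v) ∧ ∃ v ∈ P, 0 < l' v ∧ l v - t * l' v = 0 := by
  -- The multiple is the least ratio `l v / l' v` over the points where `l'` is positive. The
  -- minimum is attained, which gives the new zero.
  obtain ⟨w, ⟨hw, hw'⟩, hmin⟩ := Set.exists_min_image {v ∈ P | 0 < l' v} (fun v => l v / l' v)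
    (hP.subset fun v hv => hv.1) hl'.exists_pos
  refine ⟨l w / l' w, div_nonneg (h w hw) hw'.le, fun v hv => ?_, w, hw, hw', by field_simp; simp⟩
  obtain h0 | h0 := (hl'.1 v hv).eq_or_lt
  · rw [← h0, mul_zero, sub_zero]
    exact h v hv
  · have := (le_div_iff₀ h0).1 (hmin v ⟨hv, h0⟩)
    linarith

/-- Subtracting the largest multiple of `l` from `l'` gives a non-negative function that vanishes on
the facet and at a point off it. Maximality of the facet forces it to vanish on all of P. -/
lemma IsFacetDefining.exists_eq_mul (hP : P.Finite) (hl : IsFacetDefining P l)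
    (hl' : IsProperSupporting P l') (h : zeroFace P l ⊆ zeroFace P l') :
    ∃ t : ℝ, 0 < t ∧ ∀ v ∈ P, l' v = t * l v := by
  obtain ⟨t, ht, hnn, w, hw, hw', h0⟩ := exists_sub_smul_nonneg hP hl'.1 hl.1
  have hall : ∀ v ∈ P, l' v - t * l v = 0 := by
    by_contra! hc
    obtain ⟨v, hv, hv'⟩ := hc
    have h1 := hl.2 (l' - t • l) (isProperSupporting_of_pos (by simpa using hnn) hv (by simpa using hv'))
      fun u hu => ⟨hu.1, by simp [hu.2, (h hu).2]⟩
    have : w ∈ zeroFace P l := h1 ▸ ⟨hw, by simpa using h0⟩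
    exact hw'.ne' this.2
  refine ⟨t, ht.lt_of_ne ?_, fun v hv => by linarith [hall v hv]⟩
  rintro rfl
  obtain ⟨v, hv, hv'⟩ := hl'.exists_pos
  have := hall v hv
  simp at this
  linarith

/-- A function that is minimal on a facet and not constant takes as many values as a function
defining the facet. -/
lemma IsFacetDefining.encard_image_eq (hP : P.Finite) (hl : IsFacetDefining P l)
    (hmin : ∀ v ∈ P, l v = 0 → ∀ w ∈ P, l' v ≤ l' w) (hnc : ∃ v ∈ P, ∃ w ∈ P, l' v ≠ l' w) :
    (l' '' P).encard = (l '' P).encard ∧ ∃ v ∈ P, l v = 0 := by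
  obtain ⟨v, hv, w, hw, hvw⟩ := hnc
  obtain ⟨u, hu, hu'⟩ := Set.exists_min_image P l' hP ⟨v, hv⟩
  obtain ⟨z, hz, hz'⟩ : ∃ z ∈ P, l' z - l' u ≠ 0 := by
    by_contra! hc
    exact hvw (by linarith [hc v hv, hc w hw])
  obtain ⟨t, ht, h⟩ := hl.exists_eq_mul hP (l' := l' - AffineMap.const ℝ W (l' u))
    (isProperSupporting_of_pos (fun v hv => by simpa using hu' v hv) hz (by simpa using hz'))
    fun x hx => ⟨hx.1, by simpa using sub_eq_zero.2 ((hmin x hx.1 hx.2 u hu).antisymm (hu' x hx.1))⟩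
  refine ⟨?_, u, hu, ?_⟩
  · have : l' '' P = (fun r => t * r + l' u) '' (l '' P) := by
      rw [Set.image_image]
      refine Set.image_congr fun v hv => ?_
      have := h v hv
      simp at this
      linarith
    rw [this, Function.Injective.encard_image]
    intro r s hrs
    simpa [ht.ne'] using hrs
  · have := h u hu
    simpa [ht.ne'] using this

/-- Every proper face that avoids `v` lies in a facet that avoids `v`. -/
lemma exists_isFacetDefining (hP : P.Finite) (hl : ∀ v ∈ P, 0 ≤ l v) {v : W} (hv : v ∈ P)
    (hlv : 0 < l v) :
    ∃ l', IsFacetDefining P l' ∧ zeroFace P l ⊆ zeroFace P l' ∧ 0 < l' v := by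
  have hf : {F | ∃ m : W →ᵃ[ℝ] ℝ, (∀ v ∈ P, 0 ≤ m v) ∧ zeroFace P m = F ∧ zeroFace P l ⊆ F ∧
      0 < m v}.Finite := hP.finite_subsets.subset fun F ⟨m, _, hm, _⟩ => hm ▸ fun v hv => hv.1
  obtain ⟨F, hF⟩ := hf.exists_maximal ⟨_, l, hl, rfl, subset_rfl, hlv⟩
  obtain ⟨m, hm, rfl, hlm, hmv⟩ := hF.prop
  refine ⟨m, ⟨isProperSupporting_of_pos hm hv hmv.ne', fun l' hl' hml' => ?_⟩, hlm, hmv⟩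
  obtain h0 | h0 := (hl'.1 v hv).eq_or_lt
  -- If the larger face contains v, subtracting a multiple of `l'` from `m` leaves the value at v
  -- unchanged and creates a zero outside the larger face, against the maximal choice of F.
  · obtain ⟨t, ht, hnn, w, hw, hw', hw0⟩ := exists_sub_smul_nonneg hP hm hl'
    have hsub : zeroFace P m ⊆ zeroFace P (m - t • l') :=
      fun u hu => ⟨hu.1, by simp [hu.2, (hml' hu).2]⟩
    have h1 := hF.le_of_ge (y := zeroFace P (m - t • l'))
      ⟨m - t • l', by simpa using hnn, rfl, hlm.trans hsub, by simpa [← h0] using hmv⟩ hsub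
    exact absurd (hml' (h1 ⟨hw, by simpa using hw0⟩)).2 hw'.ne'
  · exact (hF.le_of_ge ⟨l', hl'.1, rfl, hlm.trans hml', h0⟩ hml').antisymm hml'

end PointConfiguration

namespace Graph

variable {α β : Type*} {G : Graph α β} {B F : Set β}

/-! ### Affine functions on the base configuration -/

lemma finsum_charVec (hB : B ⊆ E(G)) (c : β → ℝ) :
    ∑ᶠ e : E(G), G.charVec B e * c e = ∑ᶠ e ∈ B, c e := by
  have : ∀ e : E(G), G.charVec B e * c e = B.indicator c e := fun e => by
    by_cases he : (e : β) ∈ B <;> simp [charVec, he]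
  rw [finsum_congr this, finsum_set_coe_eq_finsum_mem, finsum_mem_def, Set.indicator_indicator,
    Set.inter_eq_right.2 hB, finsum_mem_def]

lemma exists_affineMap_eq (hE : E(G).Finite) (a : ℝ) (c : β → ℝ) :
    ∃ l : (E(G) → ℝ) →ᵃ[ℝ] ℝ, ∀ B ⊆ E(G), l (G.charVec B) = a + ∑ᶠ e ∈ B, c e := by
  have := hE.fintype
  refine ⟨AffineMap.const ℝ _ a + (∑ e : E(G), c e • LinearMap.proj e : (E(G) → ℝ) →ₗ[ℝ] ℝ).toAffineMap,
    fun B hB => ?_⟩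
  rw [← finsum_charVec hB, finsum_eq_sum_of_fintype]
  simp [mul_comm]

lemma exists_eq_add_finsum (hE : E(G).Finite) (l : (E(G) → ℝ) →ᵃ[ℝ] ℝ) :
    ∃ (a : ℝ) (c : β → ℝ), ∀ B ⊆ E(G), l (G.charVec B) = a + ∑ᶠ e ∈ B, c e := by
  classical
  have := hE.fintype
  refine ⟨l 0, fun e => if h : e ∈ E(G) then l.linear (fun f => if ⟨e, h⟩ = f then 1 else 0) else 0,
    fun B hB => ?_⟩
  rw [← finsum_charVec hB, finsum_eq_sum_of_fintype]
  have := l.map_vadd 0 (G.charVec B)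
  simp only [vadd_eq_add, add_zero] at this
  rw [this, LinearMap.pi_apply_eq_sum_univ, add_comm]
  simp

lemma finsum_indicator_one (hB : B.Finite) :
    ∑ᶠ e ∈ B, F.indicator (1 : β → ℝ) e = (B ∩ F).ncard := by
  rw [finsum_mem_def, Set.indicator_indicator, ← finsum_mem_def,
    finsum_mem_eq_finite_toFinset_sum _ (hB.subset Set.inter_subset_left),
    Set.ncard_eq_toFinset_card _ (hB.subset Set.inter_subset_left)]
  simp

lemma finite_baseConfiguration (hE : E(G).Finite) : G.baseConfiguration.Finite := by
  refine (hE.finite_subsets.image G.charVec).subset ?_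
  rintro _ ⟨B, hB, rfl⟩
  exact ⟨B, hB.prop.1, rfl⟩

lemma IsSpanningForest.charVec_mem (hB : G.IsSpanningForest B) :
    G.charVec B ∈ G.baseConfiguration := ⟨B, hB, rfl⟩

end Graph

/-! ### Contraction of biconnected relations -/

section Contraction

open Relation

variable {V V' : Type*} {r : V → V → Prop} {r' : V' → V' → Prop} {S M : Set V} {x y : V}

/-- Any two points of `S` are joined by an `r`-walk inside `S`. -/
def ConnOn (r : V → V → Prop) (S : Set V) : Prop :=
  ∀ x ∈ S, ∀ y ∈ S, ReflTransGen (fun a b => r a b ∧ a ∈ S ∧ b ∈ S) x y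

/-- `S` is connected and remains so when any one of its points is removed. -/
def BiconnOn (r : V → V → Prop) (S : Set V) : Prop :=
  ConnOn r S ∧ ∀ v ∈ S, ConnOn r (S \ {v})

lemma Relation.ReflTransGen.exists_exit {K : Set V} (h : ReflTransGen r x y) (hx : x ∈ K)
    (hy : y ∉ K) : ∃ a ∈ K, ∃ b ∉ K, r a b := by
  induction h with
  | refl => exact absurd hx hy
  | @tail b c _ hbc ih =>
    by_cases hb : b ∈ K
    · exact ⟨b, hb, c, hy, hbc⟩
    · exact ih hb

lemma Relation.ReflTransGen.symm_on (hr : ∀ a b, r a b → r b a)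
    (h : ReflTransGen (fun a b => r a b ∧ a ∈ S ∧ b ∈ S) x y) :
    ReflTransGen (fun a b => r a b ∧ a ∈ S ∧ b ∈ S) y x := by
  induction h with
  | refl => exact .refl
  | tail _ h ih => exact .head ⟨hr _ _ h.1, h.2.2, h.2.1⟩ ih

lemma Relation.ReflTransGen.mem_on
    (h : ReflTransGen (fun a b => r a b ∧ a ∈ S ∧ b ∈ S) x y) (hx : x ∈ S) : y ∈ S := by
  induction h with
  | refl => exact hx
  | tail _ h _ => exact h.2.2

lemma connOn_of_subsingleton (h : S.Subsingleton) : ConnOn r S := by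
  intro x hx y hy
  rw [h hx hy]

lemma connOn_of_root (hr : ∀ a b, r a b → r b a) (x : V)
    (h : ∀ y ∈ S, ReflTransGen (fun a b => r a b ∧ a ∈ S ∧ b ∈ S) x y) : ConnOn r S :=
  fun y hy z hz => ((h y hy).symm_on hr).trans (h z hz)

lemma ConnOn.map {S' : Set V'} (h : ConnOn r S) (f : V → V') (hf : ∀ x ∈ S, f x ∈ S')
    (hsurj : ∀ y ∈ S', ∃ x ∈ S, f x = y)
    (hr : ∀ a ∈ S, ∀ b ∈ S, r a b → f a = f b ∨ r' (f a) (f b)) : ConnOn r' S' := by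
  intro x' hx' y' hy'
  obtain ⟨x, hx, rfl⟩ := hsurj x' hx'
  obtain ⟨y, hy, rfl⟩ := hsurj y' hy'
  have h1 := h x hx y hy
  clear hy' hy
  induction h1 with
  | refl => exact .refl
  | tail _ h ih =>
    obtain ⟨h1, h2, h3⟩ := h
    obtain h4 | h4 := hr _ h2 _ h3 h1
    · rwa [← h4]
    · exact ih.tail ⟨h4, hf _ h2, hf _ h3⟩

lemma ConnOn.of_fibers {T : Set V'} (h : ConnOn r' T) (f : V → V') (hf : ∀ x ∈ S, f x ∈ T)
    (hfib : ∀ t ∈ T, ConnOn r {x ∈ S | f x = t})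
    (hlift : ∀ s ∈ T, ∀ t ∈ T, r' s t → ∃ a ∈ S, ∃ b ∈ S, f a = s ∧ f b = t ∧ r a b) :
    ConnOn r S := by
  have hmono : ∀ t ∈ T, ∀ a ∈ S, ∀ b ∈ S, f a = t → f b = t →
      ReflTransGen (fun a b => r a b ∧ a ∈ S ∧ b ∈ S) a b := fun t ht a ha b hb hat hbt =>
    ReflTransGen.mono (fun _ _ h => ⟨h.1, h.2.1.1, h.2.2.1⟩) _ _ (hfib t ht a ⟨ha, hat⟩ b ⟨hb, hbt⟩)
  intro x hx y hy
  have key : ∀ t, ReflTransGen (fun a b => r' a b ∧ a ∈ T ∧ b ∈ T) (f x) t → ∀ z ∈ S, f z = t →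
      ReflTransGen (fun a b => r a b ∧ a ∈ S ∧ b ∈ S) x z := by
    intro t ht
    induction ht with
    | refl => exact fun z hz hzt => hmono _ (hf x hx) x hx z hz rfl hzt
    | tail _ h ih =>
      intro z hz hzt
      obtain ⟨a, ha, b, hb, has, hbt, hab⟩ := hlift _ h.2.1 _ h.2.2 h.1
      exact ((ih a ha has).tail ⟨hab, ha, hb⟩).trans (hmono _ h.2.2 b hb z hz hbt hzt)
  exact key _ (h _ (hf x hx) _ (hf y hy)) y hy rfl

lemma BiconnOn.mono {r₂ : V → V → Prop} (h : BiconnOn r S)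
    (hr : ∀ a ∈ S, ∀ b ∈ S, r a b → r₂ a b) : BiconnOn r₂ S :=
  ⟨h.1.map id (fun _ h => h) (fun y hy => ⟨y, hy, rfl⟩) fun a ha b hb hab => .inr (hr a ha b hb hab),
    fun v hv => (h.2 v hv).map id (fun _ h => h) (fun y hy => ⟨y, hy, rfl⟩)
      fun a ha b hb hab => .inr (hr a ha.1 b hb.1 hab)⟩

/-- Every point of a biconnected set has a neighbour such that removing both leaves a connected
set. -/
lemma BiconnOn.exists_connOn_sdiff (hr : ∀ a b, r a b → r b a) (hS : S.Finite)
    (h : BiconnOn r S) (hx : x ∈ S) (hne : ∃ y ∈ S, y ≠ x) :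
    ∃ y ∈ S, y ≠ x ∧ r x y ∧ ConnOn r (S \ {x, y}) := by
  obtain ⟨ρ, hρ, hρx⟩ := hne
  -- `K y` is the component of ρ after removal of x and y, and is empty if y = ρ. A neighbour y of x
  -- with the largest `K y` will do.
  let K : V → Set V := fun y =>
    {z | y ≠ ρ ∧ ReflTransGen (fun a b => r a b ∧ a ∈ S \ {x, y} ∧ b ∈ S \ {x, y}) ρ z}
  have hKS : ∀ y, K y ⊆ S \ {x, y} := fun y z hz =>
    hz.2.mem_on ⟨hρ, by simp [hρx, hz.1.symm]⟩
  obtain ⟨a, ha, b, hb, hab⟩ := (h.1 x hx ρ hρ).exists_exit (K := {x}) rfl hρx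
  obtain rfl : a = x := ha
  obtain ⟨y, ⟨hyS, hyx, hay⟩, hmax⟩ := Set.exists_max_image {y | y ∈ S ∧ y ≠ a ∧ r a y}
    (fun y => (K y).ncard) (hS.subset fun y hy => hy.1) ⟨b, hab.2.2, hb, hab.1⟩
  refine ⟨y, hyS, hyx, hay, ?_⟩
  by_contra hcon
  obtain ⟨z, hz, hzK⟩ : ∃ z ∈ S \ {a, y}, z ∉ K y := by
    by_contra! hall
    exact hcon (connOn_of_root hr ρ fun z hz => (hall z hz).2)
  -- Since S without y is connected, the points outside `K y` have an edge leaving them. It can only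
  -- lead to x, so its end y' is a neighbour of x outside `K y`.
  obtain ⟨y', hy'L, c, hc, hyc, hy'S, hcS⟩ := (h.2 y hyS z ⟨hz.1, fun h => hz.2 (.inr h)⟩ a
    ⟨hx, fun h => hyx h.symm⟩).exists_exit (K := (S \ {a, y}) \ K y) ⟨hz, hzK⟩ (by simp)
  obtain rfl : c = a := by
    by_contra hca
    have hcSay : c ∈ S \ {a, y} := ⟨hcS.1, by simpa [hca] using hcS.2⟩
    have hcK : c ∈ K y := by
      by_contra hcK
      exact hc ⟨hcSay, hcK⟩
    exact hy'L.2 ⟨hcK.1, hcK.2.tail ⟨hr _ _ hyc, hcSay, hy'L.1⟩⟩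
  have hy'y : y' ≠ y := fun h => hy'L.1.2 (.inr h)
  have hy'c : y' ≠ c := fun h => hy'L.1.2 (.inl h)
  -- Removing y' in place of y keeps `K y` intact and also joins y to it, because S without x is
  -- connected.
  have hlt : (K y).ncard < (K y').ncard := by
    refine Set.ncard_lt_ncard ?_ (hS.subset ((hKS y').trans Set.sdiff_subset))
    by_cases hyρ : y = ρ
    · subst hyρ
      exact ⟨fun u hu => absurd rfl hu.1, fun hsub => (hsub (a := y) ⟨hy'y, .refl⟩).1 rfl⟩
    have hρK : ρ ∈ K y := ⟨hyρ, .refl⟩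
    have hy'ρ : y' ≠ ρ := fun h => hy'L.2 (h ▸ hρK)
    have hsub : K y ⊆ K y' := by
      rintro u ⟨-, hu⟩
      refine ⟨hy'ρ, ?_⟩
      have : ∀ u, ReflTransGen (fun a b => r a b ∧ a ∈ S \ {c, y} ∧ b ∈ S \ {c, y}) ρ u →
          u ≠ y' := fun u hu h => hy'L.2 (h ▸ ⟨hyρ, hu⟩)
      induction hu with
      | refl => exact .refl
      | tail h1 h2 ih =>
        refine ih.tail ⟨h2.1, ⟨h2.2.1.1, ?_⟩, ⟨h2.2.2.1, ?_⟩⟩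
        · have h3 := h2.2.1.2
          have := this _ h1
          simp_all
        · have h3 := h2.2.2.2
          have := this _ (h1.tail h2)
          simp_all
    refine ⟨hsub, fun hsub' => ?_⟩
    obtain ⟨s, hs, t, ht, hst, hs', ht'⟩ := (h.2 c hx ρ ⟨hρ, hρx⟩ y ⟨hyS, hyx⟩).exists_exit
      hρK (fun hy => (hKS y hy).2 (.inr rfl))
    obtain rfl : t = y := by
      by_contra hty
      exact ht ⟨hs.1, hs.2.tail ⟨hst, hKS _ hs, ht'.1, by
        have := ht'.2
        simp_all⟩⟩
    have : t ∈ K y' := ⟨hy'ρ, (hsub hs).2.tail ⟨hst, hKS _ (hsub hs), ht'.1, by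
      simpa [hyx] using hy'y.symm⟩⟩
    exact (hKS _ (hsub' this)).2 (.inr rfl)
  exact absurd (hmax y' ⟨hy'S.1, hy'c, hr _ _ hyc⟩) (not_le.2 hlt)

/-- A biconnected set with at least `m ≥ 2` marked points can be contracted to a biconnected set
of exactly `m` points, each of which comes from a marked point. -/
theorem BiconnOn.exists_contraction {m : ℕ} (hm : 2 ≤ m) (hr : ∀ a b, r a b → r b a)
    (hS : S.Finite) (h : BiconnOn r S) (hMS : M ⊆ S) (hM : m ≤ M.ncard) :
    ∃ (f : V → V) (T : Set V), T.ncard = m ∧ (∀ x ∈ S, f x ∈ T) ∧ (∀ t ∈ T, ∃ x ∈ M, f x = t) ∧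
      (∀ t ∈ T, ConnOn r {x ∈ S | f x = t}) ∧
      BiconnOn (fun s t => ∃ a ∈ S, ∃ b ∈ S, f a = s ∧ f b = t ∧ r a b) T := by
  classical
  induction hn : S.ncard generalizing S M r with
  | zero =>
    have := Set.ncard_le_ncard hMS hS
    omega
  | succ n ih =>
  have hMle := Set.ncard_le_ncard hMS hS
  obtain hmn | hmn := (hM.trans hMle).eq_or_lt
  · obtain rfl : M = S := Set.eq_of_subset_of_ncard_le hMS (by omega) hS
    refine ⟨id, M, hmn.symm, fun _ h => h, fun t ht => ⟨t, ht, rfl⟩, fun t _ => ?_, ?_⟩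
    · exact connOn_of_subsingleton fun a ha b hb => ha.2.trans hb.2.symm
    · exact h.mono fun a ha b hb hab => ⟨a, ha, b, hb, rfl, rfl, hab⟩
  -- An unmarked point is contracted if there is one. If all points are marked, one mark can be
  -- spared because S has more than m points.
  obtain ⟨x, hxS, hx⟩ : ∃ x ∈ S, m ≤ (M \ {x}).ncard := by
    by_cases hMS' : S ⊆ M
    · obtain rfl := hMS.antisymm hMS'
      obtain ⟨x, hx⟩ : M.Nonempty := by
        rw [← Set.ncard_pos hS]
        omega
      refine ⟨x, hx, ?_⟩
      rw [Set.ncard_sdiff_singleton_of_mem hx]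
      omega
    · obtain ⟨x, hx, hxM⟩ := Set.not_subset.1 hMS'
      exact ⟨x, hx, by rwa [Set.sdiff_singleton_eq_self hxM]⟩
  obtain ⟨y, hyS, hyx, hxy, hcon⟩ := h.exists_connOn_sdiff hr hS hxS (by
    obtain ⟨y, hy, hyx⟩ := Set.exists_ne_of_one_lt_ncard (s := S) (by omega) x
    exact ⟨y, hy, hyx⟩)
  let g : V → V := fun z => if z = x then y else z
  have hgx : g x = y := if_pos rfl
  have hg : ∀ z, z ≠ x → g z = z := fun z hz => if_neg hz
  have hgS : ∀ z ∈ S, g z ∈ S \ {x} := fun z hz => by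
    by_cases hzx : z = x
    · subst hzx
      exact hgx ▸ ⟨hyS, hyx⟩
    · exact (hg z hzx).symm ▸ ⟨hz, hzx⟩
  let r₁ : V → V → Prop := fun s t => ∃ a ∈ S, ∃ b ∈ S, g a = s ∧ g b = t ∧ r a b
  -- Removing the merged point y amounts to removing both x and y from S, which is where the choice
  -- of y enters. Removing any other point commutes with the merging.
  have hb : BiconnOn r₁ (S \ {x}) := by
    refine ⟨h.1.map g hgS (fun z hz => ⟨z, hz.1, hg z hz.2⟩)
      fun a ha b hb hab => .inr ⟨a, ha, b, hb, rfl, rfl, hab⟩, fun v hv => ?_⟩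
    by_cases hvy : v = y
    · subst hvy
      rw [Set.sdiff_sdiff, Set.singleton_union]
      exact hcon.map id (fun _ h => h) (fun z hz => ⟨z, hz, rfl⟩) fun a ha b hb hab =>
        .inr ⟨a, ha.1, b, hb.1, hg a fun h => ha.2 (.inl h), hg b fun h => hb.2 (.inl h), hab⟩
    · refine (h.2 v hv.1).map g (fun z hz => ⟨hgS z hz.1, ?_⟩)
        (fun z hz => ⟨z, ⟨hz.1.1, hz.2⟩, hg z hz.1.2⟩)
        fun a ha b hb hab => .inr ⟨a, ha.1, b, hb.1, rfl, rfl, hab⟩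
      by_cases hzx : z = x
      · rw [hzx, hgx]
        exact fun h => hvy h.symm
      · rw [hg z hzx]
        exact hz.2
  obtain ⟨f, T, hT, hfT, hTM, hfib, hbi⟩ := ih (r := r₁) (S := S \ {x}) (M := M \ {x})
    (fun s t ⟨a, ha, b, hb, has, hbt, hab⟩ => ⟨b, hb, a, ha, hbt, has, hr _ _ hab⟩)
    (hS.subset Set.sdiff_subset) hb (Set.sdiff_subset_sdiff_left hMS) hx
    (by rw [Set.ncard_sdiff_singleton_of_mem hxS]; omega)
  refine ⟨f ∘ g, T, hT, fun z hz => hfT _ (hgS z hz), fun t ht => ?_, fun t ht => ?_, ?_⟩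
  · obtain ⟨z, hz, hzt⟩ := hTM t ht
    exact ⟨z, hz.1, by rw [Function.comp_apply, hg z hz.2, hzt]⟩
  · refine (hfib t ht).of_fibers g (fun z hz => ⟨hgS z hz.1, hz.2⟩) (fun s hs => ?_) ?_
    · by_cases hsy : s = y
      · subst hsy
        have hsub : ∀ z ∈ {z ∈ {z ∈ S | (f ∘ g) z = t} | g z = s}, z = x ∨ z = s := by
          intro z hz
          by_cases hzx : z = x
          · exact .inl hzx
          · exact .inr ((hg z hzx).symm.trans hz.2)
        have hxm : x ∈ {z ∈ {z ∈ S | (f ∘ g) z = t} | g z = s} :=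
          ⟨⟨hxS, by rw [Function.comp_apply, hgx]; exact hs.2⟩, hgx⟩
        have hsm : s ∈ {z ∈ {z ∈ S | (f ∘ g) z = t} | g z = s} :=
          ⟨⟨hyS, by rw [Function.comp_apply, hg s hyx]; exact hs.2⟩, hg s hyx⟩
        refine connOn_of_root hr x fun z hz => ?_
        obtain rfl | rfl := hsub z hz
        · exact .refl
        · exact .single ⟨hxy, hxm, hsm⟩
      · refine connOn_of_subsingleton fun a ha b hb => ?_
        have hax : ∀ a, g a = s → a = s := fun a ha => by
          by_cases hax : a = x
          · rw [hax, hgx] at ha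
            exact absurd ha.symm hsy
          · exact (hg a hax).symm.trans ha
        rw [hax a ha.2, hax b hb.2]
    · rintro _ hs _ ht ⟨a, ha, b, hb, rfl, rfl, hab⟩
      exact ⟨a, ⟨ha, hs.2⟩, b, ⟨hb, ht.2⟩, rfl, rfl, hab⟩
  · refine hbi.mono ?_
    rintro _ - _ - ⟨_, -, _, -, rfl, rfl, a, ha, b, hb, rfl, rfl, hab⟩
    exact ⟨a, ha, b, hb, rfl, rfl, hab⟩

end Contraction

namespace Graph

variable {α β : Type*} {G : Graph α β} {U W : Set α} {k : ℕ}

/-! ### Cones as minors -/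

lemma isPreconnected_iff : G.IsPreconnected ↔ ConnOn G.Adj V(G) := by
  have : (fun a b => G.Adj a b ∧ a ∈ V(G) ∧ b ∈ V(G)) = G.Adj := by
    ext a b
    exact ⟨fun h => h.1, fun h => ⟨h, h.left_mem, h.right_mem⟩⟩
  rw [ConnOn, this]
  rfl

lemma isPreconnected_induce (h : ConnOn G.Adj U) : (G.induce U).IsPreconnected := by
  refine isPreconnected_iff.2 (h.map id (fun _ h => h) (fun y hy => ⟨y, hy, rfl⟩) ?_)
  rintro a ha b hb ⟨e, he⟩
  exact .inr ⟨e, he, ha, hb⟩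

lemma isPreconnected_deleteVerts_iff {v : α} :
    (G.deleteVerts {v}).IsPreconnected ↔ ConnOn G.Adj (V(G) \ {v}) := by
  rw [isPreconnected_iff, vertexSet_deleteVerts]
  constructor <;> refine fun h => h.map id (fun _ h => h) (fun y hy => ⟨y, hy, rfl⟩) ?_
  · rintro a - b - ⟨e, he⟩
    exact .inr ⟨e, (deleteVerts_isLink _ _).1 he |>.1⟩
  · rintro a ha b hb ⟨e, he⟩
    exact .inr ⟨e, (deleteVerts_isLink _ _).2 ⟨he, ha.2, hb.2⟩⟩

lemma isBiconnected_iff : G.IsBiconnected ↔ V(G).Nonempty ∧ BiconnOn G.Adj V(G) := by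
  simp only [IsBiconnected, IsConnected, isPreconnected_iff (G := G),
    isPreconnected_deleteVerts_iff, BiconnOn, and_assoc]

/-- The graph on `V` whose edges are the unordered pairs in `s`. -/
def ofPairs {V : Type*} (s : Set (Sym2 V)) : Graph V (Sym2 V) where
  vertexSet := Set.univ
  IsLink e x y := e ∈ s ∧ e = s(x, y)
  isLink_symm e _ := ⟨fun x y h => ⟨h.1, h.2.trans Sym2.eq_swap⟩⟩
  eq_or_eq_of_isLink_of_isLink := by
    rintro e x y v w ⟨-, rfl⟩ ⟨-, h⟩
    obtain ⟨rfl, -⟩ | ⟨rfl, -⟩ := Sym2.eq_iff.1 h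
    exacts [.inl rfl, .inr rfl]
  left_mem_of_isLink _ _ _ _ := Set.mem_univ _

lemma ofPairs_deleteEdges {V : Type*} (s : Set (Sym2 V)) (e : Sym2 V) :
    (ofPairs s).deleteEdges {e} = ofPairs (s \ {e}) := by
  refine Graph.ext rfl fun f x y => ?_
  simp only [deleteEdges_isLink, ofPairs, Set.mem_sdiff]
  tauto

lemma ofPairs_adj {V : Type*} {s : Set (Sym2 V)} {x y : V} :
    (ofPairs s).Adj x y ↔ s(x, y) ∈ s := by
  constructor
  · rintro ⟨_, h, rfl⟩
    exact h
  · exact fun h => ⟨_, h, rfl⟩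

/-- A biconnected relation on a finite type contains a minimally biconnected graph. -/
lemma exists_isMinimallyBiconnected {V : Type*} [Finite V] [Nonempty V] {q : V → V → Prop}
    (hq : ∀ a b, q a b → q b a) (h : BiconnOn q Set.univ) :
    ∃ s : Set (Sym2 V), (ofPairs s).IsMinimallyBiconnected ∧ ∀ x y, s(x, y) ∈ s → x ≠ y ∧ q x y := by
  let s₀ : Set (Sym2 V) := {e | ∃ x y, e = s(x, y) ∧ x ≠ y ∧ q x y}
  have h₀ : (ofPairs s₀).IsBiconnected := by
    have hstep : ∀ a b, q a b → a = b ∨ (ofPairs s₀).Adj a b := fun a b hab =>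
      or_iff_not_imp_left.2 fun hne => ofPairs_adj.2 ⟨a, b, rfl, hne, hab⟩
    exact isBiconnected_iff.2 ⟨Set.univ_nonempty,
      h.1.map id (fun _ h => h) (fun y hy => ⟨y, hy, rfl⟩) fun a _ b _ => hstep a b,
      fun v hv => (h.2 v hv).map id (fun _ h => h) (fun y hy => ⟨y, hy, rfl⟩)
        fun a _ b _ => hstep a b⟩
  obtain ⟨s, hs⟩ := (Set.toFinite {s | s ⊆ s₀ ∧ (ofPairs s).IsBiconnected}).exists_minimal
    ⟨s₀, subset_rfl, h₀⟩
  refine ⟨s, ⟨hs.prop.2, fun e he hb => ?_⟩, fun x y hxy => ?_⟩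
  · rw [ofPairs_deleteEdges] at hb
    obtain ⟨x, y, he, -⟩ := he
    exact (hs.le_of_le ⟨Set.sdiff_subset.trans hs.prop.1, hb⟩ Set.sdiff_subset he).2 rfl
  · obtain ⟨a, b, hab, hne, hqab⟩ := hs.prop.1 hxy
    obtain ⟨rfl, rfl⟩ | ⟨rfl, rfl⟩ := Sym2.eq_iff.1 hab
    exacts [⟨hne, hqab⟩, ⟨hne.symm, hq _ _ hqab⟩]

/-- A biconnected set of vertices together with a disjoint connected set that is adjacent to at
least `k + 1` of its vertices gives a minor that is a cone. -/
theorem exists_cone_isMinorOf (hV : V(G).Finite) (hU : U ⊆ V(G)) (hW : W ⊆ V(G))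
    (hUW : Disjoint U W) (hk : 1 ≤ k) (hbi : BiconnOn G.Adj U) (hWc : ConnOn G.Adj W)
    (hN : k + 1 ≤ {u ∈ U | ∃ w ∈ W, G.Adj u w}.ncard) :
    ∃ (α' β' : Type) (H : Graph α' β'),
      V(H).ncard = k + 1 ∧ H.IsMinimallyBiconnected ∧ H.cone.IsMinorOf G := by
  obtain ⟨f, T, hT, hfT, hTN, hfib, hbiT⟩ := hbi.exists_contraction (by omega)
    (fun _ _ h => h.symm) (hV.subset hU) (Set.sep_subset _ _) hN
  have : Finite T := Set.finite_of_ncard_ne_zero (by omega)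
  let ι : Fin (k + 1) ≃ T := (Finite.equivFinOfCardEq (α := T) hT).symm
  have hι : ∀ i j, (ι i : α) = ι j → i = j := fun i j h => ι.injective (Subtype.ext h)
  let q : Fin (k + 1) → Fin (k + 1) → Prop := fun i j =>
    ∃ a ∈ U, ∃ b ∈ U, f a = ι i ∧ f b = ι j ∧ G.Adj a b
  have hq : BiconnOn q Set.univ := by
    have hι' : ∀ t (ht : t ∈ T), (ι (ι.symm ⟨t, ht⟩) : α) = t := fun t ht => by simp
    have hg : ∀ t ∈ T, ∃ i, (ι i : α) = t := fun t ht => ⟨_, hι' t ht⟩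
    choose! g hg using hg
    have hgι : ∀ i, g (ι i) = i := fun i => hι _ _ (hg _ (ι i).2)
    refine ⟨hbiT.1.map g (fun _ _ => Set.mem_univ _) (fun i _ => ⟨ι i, (ι i).2, hgι i⟩) ?_,
      fun i _ => (hbiT.2 (ι i) (ι i).2).map g (fun t ht => ⟨Set.mem_univ _, ?_⟩)
        (fun j hj => ⟨ι j, ⟨(ι j).2, fun h => hj.2 (hι _ _ h)⟩, hgι j⟩) ?_⟩
    · rintro s hs t ht ⟨a, ha, b, hb, has, hbt, hab⟩
      exact .inr ⟨a, ha, b, hb, has.trans (hg s hs).symm, hbt.trans (hg t ht).symm, hab⟩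
    · exact fun h => ht.2 ((hg t ht.1).symm.trans (congrArg (fun i => (ι i : α)) h))
    · rintro s hs t ht ⟨a, ha, b, hb, has, hbt, hab⟩
      exact .inr ⟨a, ha, b, hb, has.trans (hg s hs.1).symm, hbt.trans (hg t ht.1).symm, hab⟩
  obtain ⟨s, hs, hsq⟩ := exists_isMinimallyBiconnected
    (fun i j ⟨a, ha, b, hb, hai, hbj, hab⟩ => ⟨b, hb, a, ha, hbj, hai, hab.symm⟩) hq
  refine ⟨Fin (k + 1), Sym2 (Fin (k + 1)), ofPairs s, by simp [ofPairs, Set.ncard_univ], hs, ?_⟩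
  have hUW' : ∀ x ∈ U, x ∉ W := fun x hx hx' => Set.disjoint_left.1 hUW hx hx'
  -- The edges g of G that may represent an edge of the cone. Each g represents at most one edge of
  -- the cone, since its ends determine the fibres, and i ≠ j keeps it out of the branch sets.
  let P : Sym2 (Fin (k + 1)) ⊕ Fin (k + 1) → β → Prop := fun x g => Sum.elim
    (fun e => ∃ i j, e = s(i, j) ∧ i ≠ j ∧ ∃ a ∈ U, ∃ b ∈ U, f a = ι i ∧ f b = ι j ∧ G.IsLink g a b)
    (fun i => ∃ a ∈ U, f a = ι i ∧ ∃ w ∈ W, G.IsLink g a w) x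
  have hinr : ∀ i, ∃ g, P (Sum.inr i) g := fun i => by
    obtain ⟨a, ⟨ha, w, hw, g, hg⟩, hai⟩ := hTN (ι i) (ι i).2
    exact ⟨g, a, ha, hai, w, hw, hg⟩
  have hPex : ∀ x, ∃ g, x ∈ E((ofPairs s).cone) → P x g := by
    rintro (e | i)
    · by_cases he : Sum.inl e ∈ E((ofPairs s).cone)
      · obtain ⟨_, _, i, j, ⟨he, rfl⟩, -⟩ := he
        obtain ⟨hij, a, ha, b, hb, hai, hbj, g, hg⟩ := hsq i j he
        exact ⟨g, fun _ => ⟨i, j, rfl, hij, a, ha, b, hb, hai, hbj, hg⟩⟩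
      -- An arbitrary value for pairs that are not edges of the cone.
      · obtain ⟨g, -⟩ := hinr 0
        exact ⟨g, fun h => absurd h he⟩
    · obtain ⟨g, hg⟩ := hinr i
      exact ⟨g, fun _ => hg⟩
  choose φ hφ using hPex
  let X : Option (Fin (k + 1)) → Set α := fun x => x.elim W fun i => {u ∈ U | f u = ι i}
  refine ⟨fun x => G.induce (X x), φ, ?_, ?_, ?_, ?_, ?_⟩
  · rintro (_ | i) -
    · refine ⟨induce_le hW, ?_, isPreconnected_induce hWc⟩
      obtain ⟨a, ⟨ha, w, hw, -⟩, -⟩ := hTN (ι 0) (ι 0).2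
      exact ⟨w, hw⟩
    · refine ⟨induce_le fun x hx => hU hx.1, ?_, isPreconnected_induce (hfib _ (ι i).2)⟩
      obtain ⟨a, ⟨ha, -⟩, hai⟩ := hTN (ι i) (ι i).2
      exact ⟨a, ha, hai⟩
  · rintro (_ | i) - (_ | j) - hij
    · exact absurd rfl hij
    · exact Set.disjoint_left.2 fun a ha hb => hUW' a hb.1 ha
    · exact Set.disjoint_left.2 fun a ha hb => hUW' a ha.1 hb
    · exact Set.disjoint_left.2 fun a ha hb => hij (congrArg some (hι i j (ha.2.symm.trans hb.2)))
  · rintro (e | i) he (e' | i') he' hee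
    · obtain ⟨i, j, rfl, -, a, ha, b, hb, hai, hbj, hl⟩ := hφ _ he
      obtain ⟨i', j', rfl, -, a', ha', b', hb', hai', hbj', hl'⟩ := hφ _ he'
      rw [hee] at hl
      obtain ⟨rfl, rfl⟩ | ⟨rfl, rfl⟩ := hl.eq_and_eq_or_eq_and_eq hl'
      · rw [hι i i' (hai.symm.trans hai'), hι j j' (hbj.symm.trans hbj')]
      · rw [hι i j' (hai.symm.trans hbj'), hι j i' (hbj.symm.trans hai'), Sym2.eq_swap]
    · obtain ⟨i, j, rfl, -, a, ha, b, hb, hai, hbj, hl⟩ := hφ _ he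
      obtain ⟨a', ha', hai', w, hw, hl'⟩ := hφ _ he'
      rw [hee] at hl
      obtain ⟨rfl, rfl⟩ | ⟨rfl, rfl⟩ := hl.eq_and_eq_or_eq_and_eq hl'
      exacts [absurd hw (hUW' _ hb), absurd hw (hUW' _ ha)]
    · obtain ⟨i, j, rfl, -, a, ha, b, hb, hai, hbj, hl⟩ := hφ _ he'
      obtain ⟨a', ha', hai', w, hw, hl'⟩ := hφ _ he
      rw [← hee] at hl
      obtain ⟨rfl, rfl⟩ | ⟨rfl, rfl⟩ := hl.eq_and_eq_or_eq_and_eq hl'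
      exacts [absurd hw (hUW' _ hb), absurd hw (hUW' _ ha)]
    · obtain ⟨a, ha, hai, w, hw, hl⟩ := hφ _ he
      obtain ⟨a', ha', hai', w', hw', hl'⟩ := hφ _ he'
      rw [hee] at hl
      obtain ⟨rfl, rfl⟩ | ⟨rfl, rfl⟩ := hl.eq_and_eq_or_eq_and_eq hl'
      · rw [hι i i' (hai.symm.trans hai')]
      · exact absurd hw' (hUW' _ ha)
  · rintro (e | i) he x - ⟨c, d, hcd, hc, hd⟩
    · obtain ⟨i, j, rfl, hij, a, ha, b, hb, hai, hbj, hl⟩ := hφ _ he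
      have hab : a ∈ X x ∧ b ∈ X x := by
        obtain ⟨rfl, rfl⟩ | ⟨rfl, rfl⟩ := hl.eq_and_eq_or_eq_and_eq hcd
        exacts [⟨hc, hd⟩, ⟨hd, hc⟩]
      obtain _ | l := x
      · exact hUW' _ ha hab.1
      · exact hij ((hι i l (hai.symm.trans hab.1.2)).trans (hι j l (hbj.symm.trans hab.2.2)).symm)
    · obtain ⟨a, ha, hai, w, hw, hl⟩ := hφ _ he
      have hab : a ∈ X x ∧ w ∈ X x := by
        obtain ⟨rfl, rfl⟩ | ⟨rfl, rfl⟩ := hl.eq_and_eq_or_eq_and_eq hcd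
        exacts [⟨hc, hd⟩, ⟨hd, hc⟩]
      obtain _ | l := x
      · exact hUW' _ ha hab.1
      · exact hUW' _ hab.2.1 hw
  · rintro (e | i) p r hpr
    · obtain ⟨i, j, hij, -, a, ha, b, hb, hai, hbj, hl⟩ := hφ _ hpr.edge_mem
      obtain ⟨x, y, ⟨-, hxy⟩, rfl, rfl⟩ := hpr
      obtain ⟨rfl, rfl⟩ | ⟨rfl, rfl⟩ := Sym2.eq_iff.1 (hxy.symm.trans hij)
      · exact ⟨a, ⟨ha, hai⟩, b, ⟨hb, hbj⟩, hl⟩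
      · exact ⟨b, ⟨hb, hbj⟩, a, ⟨ha, hai⟩, hl.symm⟩
    · obtain ⟨a, ha, hai, w, hw, hl⟩ := hφ _ hpr.edge_mem
      obtain ⟨-, ⟨rfl, rfl⟩ | ⟨rfl, rfl⟩⟩ := hpr
      · exact ⟨a, ⟨ha, hai⟩, w, hw, hl⟩
      · exact ⟨w, hw, a, ⟨ha, hai⟩, hl.symm⟩

end Graph

namespace Graph

variable {α β α' β' : Type*} {G : Graph α β}

/-! ### Trees -/

lemma exists_isForest_of_connected {X : Set β} {Z : Set α} {z₀ : α} (hX : X ⊆ E(G))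
    (hE : E(G).Finite) (hZ : Z.Finite) (hz₀ : z₀ ∈ Z)
    (hXZ : ∀ e ∈ X, ∀ x y, G.IsLink e x y → x ∈ Z) (hc : ∀ z ∈ Z, G.EdgeConn X z z₀) :
    ∃ J ⊆ X, G.IsForest J ∧ (∀ z ∈ Z, G.EdgeConn J z z₀) ∧ J.ncard + 1 = Z.ncard := by
  obtain ⟨J, -, hJX, hJ, h⟩ :=
    (IsForest.empty (G := G)).exists_maximal (Set.empty_subset X) hX hE
  refine ⟨J, hJX, hJ, fun z hz => h _ _ (hc z hz), ?_⟩
  have := hJ.ncard_add_ncard (hJ.finite hE) hZ (fun e he => hXZ e (hJX he)) (R := {z₀})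
    ⟨by simpa, fun z hz => ⟨z₀, rfl, h _ _ (hc z hz)⟩, fun r hr r' hr' _ => hr.trans hr'.symm⟩
  simpa using this

/-- A connected set of edges that is not too large is a forest. -/
lemma isForest_of_ncard_le {X : Set β} {Z : Set α} {z₀ : α} (hX : X ⊆ E(G))
    (hE : E(G).Finite) (hZ : Z.Finite) (hz₀ : z₀ ∈ Z)
    (hXZ : ∀ e ∈ X, ∀ x y, G.IsLink e x y → x ∈ Z) (hc : ∀ z ∈ Z, G.EdgeConn X z z₀)
    (hcard : X.ncard + 1 ≤ Z.ncard) : G.IsForest X := by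
  obtain ⟨J, hJX, hJ, -, h⟩ := exists_isForest_of_connected hX hE hZ hz₀ hXZ hc
  exact Set.eq_of_subset_of_ncard_le hJX (by omega) (hE.subset hX) ▸ hJ

/-! ### Lifting the bases of a minor -/

section Lift

variable {N : Graph α' β'} {T : α' → Graph α β} {φ : β' → β} {n : ℕ}

lemma EdgeConn.lift {C : Set β} {Y : Set β'} {x y : α'}
    (hlink : ∀ e x y, N.IsLink e x y → ∃ u ∈ V(T x), ∃ v ∈ V(T y), G.IsLink (φ e) u v)
    (hC : ∀ x ∈ V(N), ∀ u ∈ V(T x), ∀ v ∈ V(T x), G.EdgeConn C u v) (hx : x ∈ V(N))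
    (h : N.EdgeConn Y x y) :
    ∀ u ∈ V(T x), ∀ v ∈ V(T y), G.EdgeConn (C ∪ φ '' Y) u v := by
  induction h with
  | refl => exact fun u hu v hv => (hC x hx u hu v hv).mono Set.subset_union_left
  | tail _ h ih =>
    obtain ⟨e, he, h⟩ := h
    intro u hu v hv
    obtain ⟨a, ha, b, hb, hl⟩ := hlink e _ _ h
    exact ((ih u hu a ha).tail (Or.inr ⟨e, he, rfl⟩) hl).trans
      ((hC _ h.right_mem b hb v hv).mono Set.subset_union_left)

/-- If `N` is a minor of `G`, then the spanning trees of `N` become spanning forests of `G` after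
adding a suitable fixed set of edges. -/
lemma exists_lift_isSpanningForest (hV : V(G).Finite) (hE : E(G).Finite)
    (hT : ∀ x ∈ V(N), T x ≤ G ∧ (T x).IsConnected)
    (hdisj : ∀ x ∈ V(N), ∀ y ∈ V(N), x ≠ y → Disjoint V(T x) V(T y))
    (hφ : Set.InjOn φ E(N)) (hφT : ∀ e ∈ E(N), ∀ x ∈ V(N), φ e ∉ E(T x))
    (hlink : ∀ e x y, N.IsLink e x y → ∃ u ∈ V(T x), ∃ v ∈ V(T y), G.IsLink (φ e) u v)
    (hn : V(N).ncard = n + 1) {x₀ : α'} (hx₀ : x₀ ∈ V(N)) {Y₁ : Set β'} (hY₁ : Y₁ ⊆ E(N))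
    (hY₁n : Y₁.ncard = n) (hY₁c : ∀ x ∈ V(N), N.EdgeConn Y₁ x x₀) :
    ∃ C ⊆ E(G), (∀ x ∈ V(N), ∀ u ∈ V(T x), ∀ v ∈ V(T x), G.EdgeConn C u v) ∧
      ∀ Y ⊆ E(N), Y.ncard = n → (∀ x ∈ V(N), N.EdgeConn Y x x₀) →
        G.IsSpanningForest (C ∪ φ '' Y) ∧ Disjoint C (φ '' Y) := by
  have hNfin : V(N).Finite := Set.finite_of_ncard_ne_zero (by omega)
  have hφE : ∀ e ∈ E(N), φ e ∈ E(G) := fun e he => by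
    obtain ⟨x, y, h⟩ := exists_isLink_of_mem_edgeSet he
    obtain ⟨u, -, v, -, hl⟩ := hlink e x y h
    exact hl.edge_mem
  have hφim : ∀ Y ⊆ E(N), φ '' Y ⊆ E(G) := by
    rintro Y hY _ ⟨e, he, rfl⟩
    exact hφE e (hY he)
  let X₀ : Set β := ⋃ x ∈ V(N), E(T x)
  let Z : Set α := ⋃ x ∈ V(N), V(T x)
  have hX₀ : X₀ ⊆ E(G) := Set.iUnion₂_subset fun x hx => (hT x hx).1.edgeSet_mono
  have hZV : Z ⊆ V(G) := Set.iUnion₂_subset fun x hx => (hT x hx).1.vertexSet_mono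
  have hZ : Z.Finite := hV.subset hZV
  have hTZ : ∀ x ∈ V(N), ∀ u ∈ V(T x), u ∈ Z := fun x hx u hu => Set.mem_biUnion hx hu
  have huniq : ∀ x ∈ V(N), ∀ y ∈ V(N), ∀ u, u ∈ V(T x) → u ∈ V(T y) → x = y := by
    intro x hx y hy u hux huy
    by_contra hne
    exact Set.disjoint_left.1 (hdisj x hx y hy hne) hux huy
  have hX₀link : ∀ e ∈ X₀, ∃ x ∈ V(N), ∀ a b, G.IsLink e a b → a ∈ V(T x) ∧ b ∈ V(T x) := by
    intro e he
    obtain ⟨x, hx, he⟩ := Set.mem_iUnion₂.1 he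
    refine ⟨x, hx, fun a b hl => ?_⟩
    have := ((hT x hx).1.isLink_iff he).2 hl
    exact ⟨this.left_mem, this.right_mem⟩
  -- A spanning forest of the union of the branch sets, with one class for each vertex of N.
  obtain ⟨C₀, -, hC₀X, hC₀, hC₀c⟩ :=
    (IsForest.empty (G := G)).exists_maximal (Set.empty_subset X₀) hX₀ hE
  have hTc : ∀ x ∈ V(N), ∀ u ∈ V(T x), ∀ v ∈ V(T x), G.EdgeConn C₀ u v := by
    intro x hx u hu v hv
    refine hC₀c _ _ (Relation.ReflTransGen.mono ?_ _ _ ((hT x hx).2.2 u hu v hv))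
    rintro a b ⟨e, he⟩
    exact ⟨e, Set.mem_biUnion hx he.edge_mem, he.mono (hT x hx).1⟩
  have hne : ∀ x ∈ V(N), ∃ u, u ∈ V(T x) := fun x hx => (hT x hx).2.1
  obtain ⟨z₀, hz₀⟩ := hne x₀ hx₀
  have : Nonempty α := ⟨z₀⟩
  choose! p hp using hne
  have hC₀Z : ∀ e ∈ C₀, ∀ x y, G.IsLink e x y → x ∈ Z := fun e he x y hl => by
    obtain ⟨t, ht, h⟩ := hX₀link e (hC₀X he)
    exact hTZ t ht _ (h _ _ hl).1
  have hcard₀ : C₀.ncard + (n + 1) = Z.ncard := by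
    rw [← hC₀.ncard_add_ncard (hC₀.finite hE) hZ hC₀Z (R := p '' V(N)), Set.InjOn.ncard_image, hn]
    · exact fun x hx y hy hxy => huniq x hx y hy _ (hp x hx) (hxy ▸ hp y hy)
    · refine ⟨?_, fun z hz => ?_, ?_⟩
      · rintro _ ⟨x, hx, rfl⟩
        exact hTZ x hx _ (hp x hx)
      · obtain ⟨x, hx, hz⟩ := Set.mem_iUnion₂.1 hz
        exact ⟨p x, ⟨x, hx, rfl⟩, hTc x hx _ hz _ (hp x hx)⟩
      · rintro _ ⟨x, hx, rfl⟩ _ ⟨y, hy, rfl⟩ hxy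
        have : p y ∈ V(T x) := hxy.mem_of_closed (hp x hx) fun e he a b hl ha => by
          obtain ⟨t, ht, h⟩ := hX₀link e (hC₀X he)
          exact huniq t ht x hx a (h a b hl).1 ha ▸ (h a b hl).2
        rw [huniq x hx y hy _ this (hp y hy)]
  have hYZ : ∀ Y ⊆ E(N), ∀ e ∈ φ '' Y, ∀ x y, G.IsLink e x y → x ∈ Z := by
    rintro Y hY _ ⟨e, he, rfl⟩ x y hl
    obtain ⟨s, t, hst⟩ := exists_isLink_of_mem_edgeSet (hY he)
    obtain ⟨u, hu, v, hv, hl'⟩ := hlink e s t hst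
    obtain ⟨rfl, rfl⟩ | ⟨rfl, rfl⟩ := hl.eq_and_eq_or_eq_and_eq hl'
    exacts [hTZ s hst.left_mem _ hu, hTZ t hst.right_mem _ hv]
  have hYc : ∀ Y ⊆ E(N), (∀ x ∈ V(N), N.EdgeConn Y x x₀) →
      ∀ z ∈ Z, G.EdgeConn (C₀ ∪ φ '' Y) z z₀ := fun Y hY hc z hz => by
    obtain ⟨x, hx, hz⟩ := Set.mem_iUnion₂.1 hz
    exact (hc x hx).lift hlink hTc hx z hz z₀ hz₀
  have hYcard : ∀ Y ⊆ E(N), Y.ncard = n → (φ '' Y).ncard = n := fun Y hY hYn => by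
    rw [(hφ.mono hY).ncard_image, hYn]
  -- This set connects Z and has at most |Z| - 1 edges, so it is a tree on Z.
  have hforest : G.IsForest (C₀ ∪ φ '' Y₁) := by
    refine isForest_of_ncard_le (Set.union_subset hC₀.1 (hφim Y₁ hY₁)) hE hZ
      (hTZ x₀ hx₀ z₀ hz₀) ?_ (hYc Y₁ hY₁ hY₁c) ?_
    · rintro e (he | he)
      exacts [hC₀Z e he, hYZ Y₁ hY₁ e he]
    · have := Set.ncard_union_le C₀ (φ '' Y₁)
      have := hYcard Y₁ hY₁ hY₁n
      omega
  -- The fixed set C is the rest of a spanning forest B that contains the lift of the reference tree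
  -- `Y₁`. Replacing that lift by the lift of another tree keeps the set spanning and does not
  -- enlarge it.
  obtain ⟨B, hCB, hB⟩ := hforest.exists_isSpanningForest hE
  have hBfin := hB.prop.finite hE
  have hYB : φ '' Y₁ ⊆ B := Set.subset_union_right.trans hCB
  have hBcard := Set.ncard_sdiff_add_ncard_of_subset hYB hBfin
  rw [hYcard Y₁ hY₁ hY₁n] at hBcard
  have hC₀C : C₀ ⊆ B \ φ '' Y₁ := by
    refine fun e he => ⟨hCB (.inl he), ?_⟩
    rintro ⟨f, hf, rfl⟩
    obtain ⟨x, hx, he⟩ := Set.mem_iUnion₂.1 (hC₀X he)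
    exact hφT f (hY₁ hf) x hx he
  refine ⟨B \ φ '' Y₁, Set.sdiff_subset.trans hB.prop.1,
    fun x hx u hu v hv => (hTc x hx u hu v hv).mono hC₀C, fun Y hY hYn hYconn => ?_⟩
  have hsub : (B \ φ '' Y₁) ∪ φ '' Y ⊆ E(G) :=
    Set.union_subset (Set.sdiff_subset.trans hB.prop.1) (hφim Y hY)
  have hYn' := hYcard Y hY hYn
  have hsp : G.IsSpanningForest ((B \ φ '' Y₁) ∪ φ '' Y) := by
    refine IsSpanning.isSpanningForest (fun e x y hl => ?_) hsub hV hE hB ?_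
    · refine (hB.isSpanning e x y hl).bind fun f hf a b hab => ?_
      by_cases hfY : f ∈ φ '' Y₁
      · have h1 := hYc Y hY hYconn a (hYZ Y₁ hY₁ f hfY a b hab)
        have h2 := hYc Y hY hYconn b (hYZ Y₁ hY₁ f hfY b a hab.symm)
        exact (h1.trans h2.symm).mono (Set.union_subset_union_left _ hC₀C)
      · exact EdgeConn.of_isLink (.inl ⟨hf, hfY⟩) hab
    · have := Set.ncard_union_le (B \ φ '' Y₁) (φ '' Y)
      omega
  refine ⟨hsp, (Set.ncard_union_eq_iff (hE.subset (Set.subset_union_left.trans hsub))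
    (hE.subset (Set.subset_union_right.trans hsub))).1 ?_⟩
  rw [hsp.ncard_eq hB hV hE]
  omega

end Lift

/-! ### Spanning trees of cones -/

section Cone

variable {H : Graph α' β'} {J : Set β'} {A : Set α'} {k : ℕ}

/-- The edges in `J` together with the edges from the apex to `A` connect the cone over `H`, and
their number is that of the edges of a spanning tree of the cone. -/
structure IsConeTree (H : Graph α' β') (k : ℕ) (J : Set β') (A : Set α') : Prop where
  edges_subset : J ⊆ E(H)
  verts_subset : A ⊆ V(H)
  ncard_add : J.ncard + A.ncard = k + 1
  exists_edgeConn : ∀ x ∈ V(H), ∃ a ∈ A, H.EdgeConn J x a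

lemma inl_mem_edgeSet_cone {e : β'} (he : e ∈ E(H)) : (Sum.inl e : β' ⊕ α') ∈ E(H.cone) := by
  obtain ⟨x, y, h⟩ := exists_isLink_of_mem_edgeSet he
  exact ⟨some x, some y, x, y, h, rfl, rfl⟩

lemma inr_mem_edgeSet_cone {x : α'} (hx : x ∈ V(H)) : (Sum.inr x : β' ⊕ α') ∈ E(H.cone) :=
  ⟨some x, none, hx, .inl ⟨rfl, rfl⟩⟩

lemma EdgeConn.cone {x y : α'} {Y : Set (β' ⊕ α')} (h : H.EdgeConn J x y)
    (hY : ∀ e ∈ J, Sum.inl e ∈ Y) : H.cone.EdgeConn Y (some x) (some y) := by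
  induction h with
  | refl => exact refl _
  | tail _ h ih =>
    obtain ⟨e, he, h⟩ := h
    exact ih.tail (hY e he) (show H.cone.IsLink (Sum.inl e) _ _ from ⟨_, _, h, rfl, rfl⟩)

namespace IsConeTree

lemma subset_edgeSet_cone (h : H.IsConeTree k J A) :
    Sum.inl '' J ∪ Sum.inr '' A ⊆ E(H.cone) := by
  rintro _ (⟨e, he, rfl⟩ | ⟨a, ha, rfl⟩)
  exacts [inl_mem_edgeSet_cone (h.edges_subset he), inr_mem_edgeSet_cone (h.verts_subset ha)]

lemma ncard_union (h : H.IsConeTree k J A) (hJ : J.Finite) (hA : A.Finite) :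
    (Sum.inl '' J ∪ Sum.inr '' A : Set (β' ⊕ α')).ncard = k + 1 := by
  rw [Set.ncard_union_eq Set.disjoint_image_inl_image_inr (hJ.image _) (hA.image _),
    Set.ncard_image_of_injective _ Sum.inl_injective,
    Set.ncard_image_of_injective _ Sum.inr_injective, h.ncard_add]

lemma edgeConn_cone (h : H.IsConeTree k J A) {x : Option α'} (hx : x ∈ V(H.cone)) :
    H.cone.EdgeConn (Sum.inl '' J ∪ Sum.inr '' A) x none := by
  obtain rfl | ⟨x, hx, rfl⟩ := hx
  · exact .refl _
  · obtain ⟨a, ha, hxa⟩ := h.exists_edgeConn x hx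
    exact (hxa.cone fun e he => .inl ⟨e, he, rfl⟩).tail (e := Sum.inr a) (.inr ⟨a, ha, rfl⟩)
      (show H.cone.IsLink (Sum.inr a) _ _ from ⟨h.verts_subset ha, .inl ⟨rfl, rfl⟩⟩)

end IsConeTree

lemma isConeTree_of_connected {v : α'} (hJ : J ⊆ E(H)) (hv : v ∈ V(H)) (hk : J.ncard = k)
    (h : ∀ x ∈ V(H), H.EdgeConn J x v) : H.IsConeTree k J {v} :=
  ⟨hJ, by simpa, by simpa, fun x hx => ⟨v, rfl, h x hx⟩⟩

lemma isConeTree_empty (hV : V(H).ncard = k + 1) : H.IsConeTree k ∅ V(H) :=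
  ⟨Set.empty_subset _, subset_rfl, by simpa, fun x hx => ⟨x, hx, .refl _⟩⟩

lemma IsForest.exists_isConeTree (hJ : H.IsForest J) (hE : E(H).Finite)
    (hV : V(H).ncard = k + 1) : ∃ A, H.IsConeTree k J A := by
  have hVfin : V(H).Finite := Set.finite_of_ncard_ne_zero (by omega)
  obtain ⟨A, hA, hA'⟩ := exists_isTransversal_subset (G := H) (X := J) hVfin subset_rfl
    fun z hz => ⟨z, hz, .refl _⟩
  exact ⟨A, hJ.1, hA, hV ▸ hJ.ncard_add_ncard (hJ.finite hE) hVfin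
    (fun e _ x y hl => hl.left_mem) hA', hA'.2.1⟩

lemma EdgeConn.of_connOn {S : Set α'} {X : Set β'} (h : ConnOn H.Adj S)
    (hX : ∀ e x y, H.IsLink e x y → x ∈ S → y ∈ S → e ∈ X) {x y : α'} (hx : x ∈ S) (hy : y ∈ S) :
    H.EdgeConn X x y := by
  refine Relation.ReflTransGen.mono ?_ _ _ (h x hx y hy)
  rintro a b ⟨⟨e, he⟩, ha, hb⟩
  exact ⟨e, hX e a b he ha hb, he⟩

/-- Deleting a loop does not affect biconnectedness. The absence of loops is all that the lower
bound on the number of values needs from minimality. -/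
lemma IsMinimallyBiconnected.ne_of_isLink (hH : H.IsMinimallyBiconnected) {e : β'} {x y : α'}
    (h : H.IsLink e x y) : x ≠ y := by
  rintro rfl
  refine hH.2 e h.edge_mem ?_
  obtain ⟨hne, hb⟩ := isBiconnected_iff.1 hH.1
  have hstep : ∀ a b, H.Adj a b → a = b ∨ (H.deleteEdges {e}).Adj a b := by
    rintro a b ⟨f, hf⟩
    obtain rfl | hfe := eq_or_ne f e
    · obtain ⟨rfl, rfl⟩ | ⟨rfl, rfl⟩ := hf.eq_and_eq_or_eq_and_eq h <;> exact .inl rfl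
    · exact .inr ⟨f, by simpa using ⟨hf, hfe⟩⟩
  exact isBiconnected_iff.2 ⟨hne,
    hb.1.map id (fun _ h => h) (fun y hy => ⟨y, hy, rfl⟩) fun a _ b _ => hstep a b,
    fun v hv => (hb.2 v hv).map id (fun _ h => h) (fun y hy => ⟨y, hy, rfl⟩)
      fun a _ b _ => hstep a b⟩

lemma finsum_mem_eq_ncard_mul {ι : Type*} {s : Set ι} {f : ι → ℝ} {c : ℝ} (hs : s.Finite)
    (hf : ∀ i ∈ s, f i = c) : ∑ᶠ i ∈ s, f i = s.ncard * c := by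
  rw [finsum_mem_congr rfl hf, finsum_mem_eq_finite_toFinset_sum _ hs,
    Set.ncard_eq_toFinset_card _ hs]
  simp

/-- The spanning trees of `H` with one apex edge span a hyperplane. -/
lemma IsMinimallyBiconnected.exists_eq_mul (hH : H.IsMinimallyBiconnected) (hE : E(H).Finite)
    (hV : V(H).ncard = k + 1) (hk : 1 ≤ k) (K : ℝ) (p : β' → ℝ) (q : α' → ℝ)
    (h : ∀ J v, H.IsConeTree k J {v} → K + ∑ᶠ e ∈ J, p e + q v = 0) :
    ∃ s : ℝ, ∀ J A, H.IsConeTree k J A →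
      K + ∑ᶠ e ∈ J, p e + ∑ᶠ a ∈ A, q a = s * (k - J.ncard) := by
  obtain ⟨⟨v₀, hv₀⟩, hb⟩ := isBiconnected_iff.1 hH.1
  have hVfin : V(H).Finite := Set.finite_of_ncard_ne_zero (by omega)
  obtain ⟨J₀, hJ₀E, hJ₀, hJ₀c, hJ₀k⟩ := exists_isForest_of_connected (X := E(H)) subset_rfl hE hVfin
    hv₀ (fun e _ x y hl => hl.left_mem) fun z hz =>
      EdgeConn.of_connOn hb.1 (fun e x y hl _ _ => hl.edge_mem) hz hv₀
  -- One spanning tree of H can be attached to the apex at any vertex.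
  have hq : ∀ v ∈ V(H), q v = q v₀ := fun v hv => by
    have h1 := h J₀ v (isConeTree_of_connected hJ₀E hv (by omega)
      fun x hx => (hJ₀c x hx).trans (hJ₀c v hv).symm)
    have h2 := h J₀ v₀ (isConeTree_of_connected hJ₀E hv₀ (by omega) hJ₀c)
    linarith
  -- A tree on H - v becomes a spanning tree of H with any edge at v, so all edges at v have the
  -- same weight. Connectedness then makes the weight constant on H.
  have hstar : ∀ v ∈ V(H), ∃ g : ℝ, ∀ e x, H.IsLink e v x → p e = g := by
    intro v hv
    obtain ⟨w, hw, hwv⟩ := Set.exists_ne_of_one_lt_ncard (s := V(H)) (by omega) v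
    obtain ⟨J, hJX, hJ, hJc, hJk⟩ := exists_isForest_of_connected (G := H)
      (X := {e | ∃ x y, H.IsLink e x y ∧ x ∈ V(H) \ {v} ∧ y ∈ V(H) \ {v}}) (Z := V(H) \ {v})
      (z₀ := w) (by rintro e ⟨x, y, hl, -⟩; exact hl.edge_mem) hE (hVfin.subset Set.sdiff_subset) ⟨hw, hwv⟩
      (by
        rintro e ⟨x, y, hl, hx, hy⟩ a b hab
        obtain ⟨rfl, rfl⟩ | ⟨rfl, rfl⟩ := hab.eq_and_eq_or_eq_and_eq hl
        exacts [hx, hy])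
      fun z hz => EdgeConn.of_connOn (hb.2 v hv) (by exact fun e x y hl hx hy => ⟨x, y, hl, hx, hy⟩) hz
        ⟨hw, hwv⟩
    rw [Set.ncard_sdiff_singleton_of_mem hv] at hJk
    refine ⟨-(K + ∑ᶠ e ∈ J, p e + q v), fun e x hl => ?_⟩
    have heJ : e ∉ J := fun he => by
      obtain ⟨a, b, hab, ha, hb'⟩ := hJX he
      obtain ⟨rfl, rfl⟩ | ⟨rfl, rfl⟩ := hl.eq_and_eq_or_eq_and_eq hab
      exacts [ha.2 rfl, hb'.2 rfl]
    have hxv : x ∈ V(H) \ {v} := ⟨hl.right_mem, (hH.ne_of_isLink hl).symm⟩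
    have h1 := h (insert e J) v (isConeTree_of_connected
      (Set.insert_subset hl.edge_mem hJ.1) hv
      (by rw [Set.ncard_insert_of_notMem heJ (hJ.finite hE)]; omega) fun y hy => by
        by_cases hyv : y = v
        · exact hyv ▸ .refl _
        · exact (((hJc y ⟨hy, hyv⟩).trans (hJc x hxv).symm).mono (Set.subset_insert _ _)).tail
            (Set.mem_insert _ _) hl.symm)
    rw [finsum_mem_insert _ heJ (hJ.finite hE)] at h1
    linarith
  choose! g hg using hstar
  have hgc : ∀ v ∈ V(H), g v = g v₀ := by
    intro v hv
    have := hb.1 v₀ hv₀ v hv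
    clear hv
    induction this with
    | refl => rfl
    | tail _ h ih =>
      obtain ⟨⟨e, he⟩, h1, h2⟩ := h
      rw [← ih, ← hg _ h1 e _ he, ← hg _ h2 e _ he.symm]
  have hp : ∀ e ∈ E(H), p e = g v₀ := fun e he => by
    obtain ⟨x, y, hl⟩ := exists_isLink_of_mem_edgeSet he
    rw [hg x hl.left_mem e y hl, hgc x hl.left_mem]
  refine ⟨q v₀ - g v₀, fun J A hJA => ?_⟩
  have h1 := h J₀ v₀ (isConeTree_of_connected hJ₀E hv₀ (by omega) hJ₀c)
  rw [finsum_mem_eq_ncard_mul (hE.subset hJ₀E) fun e he => hp e (hJ₀E he)] at h1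
  rw [finsum_mem_eq_ncard_mul (hE.subset hJA.edges_subset) fun e he => hp e (hJA.edges_subset he),
    finsum_mem_eq_ncard_mul (hVfin.subset hJA.verts_subset) fun a ha => hq a (hJA.verts_subset ha)]
  have h2 : (J.ncard : ℝ) + A.ncard = k + 1 := by exact_mod_cast hJA.ncard_add
  have h3 : (J₀.ncard : ℝ) = k := by
    have : J₀.ncard = k := by omega
    exact_mod_cast this
  rw [h3] at h1
  have h4 : (A.ncard : ℝ) = k + 1 - J.ncard := by linarith
  rw [h4]
  linear_combination h1

end Cone

end Graph

/-! ### Cone minors force more than k values -/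

namespace Graph

variable {α β α' β' : Type*} {G : Graph α β} {H : Graph α' β'} {k : ℕ}

/-- A graph with a minor that is the cone over a minimally biconnected graph on `k + 1` vertices
is not `k`-level. -/
theorem not_isKLevel_of_cone_isMinorOf (hV : V(G).Finite) (hE : E(G).Finite) (hk : 1 ≤ k)
    (hH : H.IsMinimallyBiconnected) (hHk : V(H).ncard = k + 1) (hmin : H.cone.IsMinorOf G) :
    ¬ G.IsKLevel k := by
  intro hlevel
  obtain ⟨T, φ, hT, hdisj, hφ, hφT, hlink⟩ := hmin
  have hVfin : V(H).Finite := Set.finite_of_ncard_ne_zero (by omega)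
  have hφE : ∀ e ∈ E(H.cone), φ e ∈ E(G) := fun e he => by
    obtain ⟨x, y, h⟩ := exists_isLink_of_mem_edgeSet he
    obtain ⟨u, -, v, -, hl⟩ := hlink e x y h
    exact hl.edge_mem
  have hEH : E(H).Finite := by
    have h1 : E(H.cone).Finite := Set.Finite.of_finite_image (hE.subset (by
      rintro _ ⟨e, he, rfl⟩
      exact hφE e he)) hφ
    exact (h1.preimage Sum.inl_injective.injOn).subset fun e he => inl_mem_edgeSet_cone he
  have hNk : V(H.cone).ncard = k + 1 + 1 := by
    change (insert none (some '' V(H))).ncard = _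
    rw [Set.ncard_insert_of_notMem (by simp) (hVfin.image _),
      Set.ncard_image_of_injective _ (Option.some_injective _), hHk]
  have htriv := isConeTree_empty hHk
  obtain ⟨C, hCE, hTC, hC⟩ := exists_lift_isSpanningForest hV hE hT hdisj hφ hφT hlink hNk
    (x₀ := none) (Set.mem_insert _ _) htriv.subset_edgeSet_cone
    (htriv.ncard_union Set.finite_empty hVfin) fun x hx => htriv.edgeConn_cone hx
  let S : Set β' → Set α' → Set β := fun J A => C ∪ φ '' (Sum.inl '' J ∪ Sum.inr '' A)
  have hS : ∀ J A, H.IsConeTree k J A → G.IsSpanningForest (S J A) ∧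
      Disjoint C (φ '' (Sum.inl '' J ∪ Sum.inr '' A)) := fun J A h =>
    hC _ h.subset_edgeSet_cone (h.ncard_union (hEH.subset h.edges_subset)
      (hVfin.subset h.verts_subset)) fun x hx => h.edgeConn_cone hx
  obtain ⟨⟨v₀, hv₀⟩, hb⟩ := isBiconnected_iff.1 hH.1
  obtain ⟨J₀, hJ₀E, hJ₀, hJ₀c, hJ₀k⟩ := exists_isForest_of_connected (X := E(H)) subset_rfl hEH
    hVfin hv₀ (fun e _ x y hl => hl.left_mem) fun z hz =>
      EdgeConn.of_connOn hb.1 (fun e x y hl _ _ => hl.edge_mem) hz hv₀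
  have htree₀ : H.IsConeTree k J₀ {v₀} := isConeTree_of_connected hJ₀E hv₀ (by omega) hJ₀c
  have hinl : Set.InjOn (fun e => φ (Sum.inl e)) E(H) := fun e he f hf hef =>
    Sum.inl_injective (hφ (inl_mem_edgeSet_cone he) (inl_mem_edgeSet_cone hf) hef)
  have hinr : Set.InjOn (fun e => φ (Sum.inr e)) V(H) := fun e he f hf hef =>
    Sum.inr_injective (hφ (inr_mem_edgeSet_cone he) (inr_mem_edgeSet_cone hf) hef)
  have hlr : ∀ e ∈ E(H), ∀ x ∈ V(H), φ (Sum.inl e) ≠ φ (Sum.inr x) := fun e he x hx h =>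
    Sum.inl_ne_inr (hφ (inl_mem_edgeSet_cone he) (inr_mem_edgeSet_cone hx) h)
  have himage : ∀ (J : Set β') (A : Set α'), φ '' (Sum.inl '' J ∪ Sum.inr '' A) =
      (fun e => φ (Sum.inl e)) '' J ∪ (fun a => φ (Sum.inr a)) '' A := fun J A => by
    rw [Set.image_union, Set.image_image, Set.image_image]
  let F : Set β := C ∪ (fun e => φ (Sum.inl e)) '' E(H)
  have hSF : ∀ J A, H.IsConeTree k J A → (S J A ∩ F).ncard = C.ncard + J.ncard := by
    intro J A h
    have hd := (hS J A h).2
    rw [himage, Set.disjoint_union_right] at hd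
    have : S J A ∩ F = C ∪ (fun e => φ (Sum.inl e)) '' J := by
      ext f
      simp only [S, F, himage]
      constructor
      · rintro ⟨h1 | h1 | ⟨a, ha, rfl⟩, h2⟩
        · exact .inl h1
        · exact .inr h1
        · obtain h2 | ⟨e, he, h2⟩ := h2
          · exact absurd ⟨a, ha, rfl⟩ (Set.disjoint_left.1 hd.2 h2)
          · exact absurd h2 (hlr e he a (h.verts_subset ha))
      · rintro (h1 | h1)
        · exact ⟨.inl h1, .inl h1⟩
        · exact ⟨.inr (.inl h1), .inr (Set.image_mono h.edges_subset h1)⟩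
    rw [this, Set.ncard_union_eq hd.1 (hE.subset hCE) ((hEH.subset h.edges_subset).image _),
      (hinl.mono h.edges_subset).ncard_image]
  -- The lift of a spanning tree of H already connects, within F, the two ends of every edge of F.
  have hFbound : ∀ B, G.IsSpanningForest B → (B ∩ F).ncard ≤ C.ncard + k := by
    intro B hB
    have hJ₀k' : J₀.ncard = k := by omega
    rw [← hJ₀k', ← hSF J₀ {v₀} htree₀]
    refine IsForest.ncard_le_ncard ((hS _ _ htree₀).1.prop.subset Set.inter_subset_left)
      (hB.prop.subset Set.inter_subset_left) hV hE ?_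
    rintro f ⟨-, hf⟩ a b hl
    have hCsub : C ⊆ S J₀ {v₀} ∩ F := fun e he => ⟨.inl he, .inl he⟩
    obtain hf | ⟨e, he, rfl⟩ := hf
    · exact EdgeConn.of_isLink (hCsub hf) hl
    · obtain ⟨x, y, hxy⟩ := exists_isLink_of_mem_edgeSet he
      obtain ⟨u, hu, v, hv, huv⟩ := hlink (Sum.inl e) (some x) (some y) ⟨x, y, hxy, rfl, rfl⟩
      have h1 := ((hJ₀c x hxy.left_mem).trans (hJ₀c y hxy.right_mem).symm).cone
        (Y := Sum.inl '' J₀) fun e he => ⟨e, he, rfl⟩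
      have h2 := (h1.lift hlink hTC (.inr ⟨x, hxy.left_mem, rfl⟩) u hu v hv).mono
        (Y := S J₀ {v₀} ∩ F) (by
          rintro g (hg | ⟨_, ⟨e, he, rfl⟩, rfl⟩)
          · exact hCsub hg
          · exact ⟨.inr ⟨_, .inl ⟨e, he, rfl⟩, rfl⟩, .inr ⟨e, hJ₀E he, rfl⟩⟩)
      obtain ⟨rfl, rfl⟩ | ⟨rfl, rfl⟩ := hl.eq_and_eq_or_eq_and_eq huv
      exacts [h2, h2.symm]
  obtain ⟨g, hg⟩ := exists_affineMap_eq hE (C.ncard + k) (fun e => - F.indicator (1 : β → ℝ) e)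
  have hg' : ∀ B, G.IsSpanningForest B → g (G.charVec B) = C.ncard + k - (B ∩ F).ncard := by
    intro B hB
    rw [hg B hB.prop.1, finsum_mem_neg_distrib _ (hB.prop.finite hE),
      finsum_indicator_one (hB.prop.finite hE)]
    ring
  have hg0 : ∀ v ∈ G.baseConfiguration, 0 ≤ g v := by
    rintro _ ⟨B, hB, rfl⟩
    rw [hg' B hB, sub_nonneg]
    exact_mod_cast hFbound B hB
  -- The face of g need not be a facet. A facet containing it suffices, provided that it avoids the
  -- lift of the star at the apex, where g equals k.
  obtain ⟨l, hl, hgl, hlpos⟩ := exists_isFacetDefining (finite_baseConfiguration hE) hg0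
    (hS _ _ htriv).1.charVec_mem (by
      rw [hg' _ (hS _ _ htriv).1, hSF _ _ htriv, Set.ncard_empty]
      have : (1 : ℝ) ≤ k := by exact_mod_cast hk
      push_cast
      linarith)
  obtain ⟨a, c, hac⟩ := exists_eq_add_finsum hE l
  have hval : ∀ J A, H.IsConeTree k J A → l (G.charVec (S J A)) =
      (a + ∑ᶠ e ∈ C, c e) + ∑ᶠ e ∈ J, c (φ (Sum.inl e)) + ∑ᶠ x ∈ A, c (φ (Sum.inr x)) := by
    intro J A h
    have hJ := hEH.subset h.edges_subset
    have hA := hVfin.subset h.verts_subset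
    rw [hac _ (hS J A h).1.prop.1]
    simp only [S]
    rw [finsum_mem_union (hS J A h).2 (hE.subset hCE) (((hJ.image _).union (hA.image _)).image _),
      himage, finsum_mem_union _ (hJ.image _) (hA.image _),
      finsum_mem_image (hinl.mono h.edges_subset), finsum_mem_image (hinr.mono h.verts_subset)]
    · ring
    · refine Set.disjoint_left.2 ?_
      rintro _ ⟨e, he, rfl⟩ ⟨x, hx, hxe⟩
      exact hlr e (h.edges_subset he) x (h.verts_subset hx) hxe.symm
  obtain ⟨s, hs⟩ := hH.exists_eq_mul hEH hHk hk _ _ _ fun J v h => by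
    have h1 : G.charVec (S J {v}) ∈ zeroFace G.baseConfiguration g := by
      refine ⟨(hS J _ h).1.charVec_mem, ?_⟩
      rw [hg' _ (hS J _ h).1, hSF _ _ h]
      have := h.ncard_add
      rw [Set.ncard_singleton] at this
      have : J.ncard = k := by omega
      rw [this]
      push_cast
      ring
    have h2 := (hgl h1).2
    rw [hval _ _ h, finsum_mem_singleton] at h2
    exact h2
  have hs0 : s ≠ 0 := by
    rintro rfl
    rw [hval _ _ htriv, hs _ _ htriv, zero_mul] at hlpos
    exact lt_irrefl _ hlpos
  -- Every j-element subset of the spanning tree `J₀` is a forest and extends by apex edges to a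
  -- spanning tree of the cone.
  have hsub : (fun j : ℕ => s * ((k : ℝ) - j)) '' Set.Iic k ⊆ l '' G.baseConfiguration := by
    rintro _ ⟨j, hj, rfl⟩
    obtain ⟨J, hJ, hJj⟩ := Set.exists_subset_card_eq (s := J₀) (n := j)
      (by rw [Set.mem_Iic] at hj; omega)
    obtain ⟨A, hA⟩ := (hJ₀.subset hJ).exists_isConeTree hEH hHk
    refine ⟨_, (hS J A hA).1.charVec_mem, ?_⟩
    rw [hval _ _ hA, hs _ _ hA, hJj]
  have h1 := (Set.encard_le_encard hsub).trans (hlevel l hl)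
  rw [Function.Injective.encard_image] at h1
  · have h2 : (Set.Iic k).encard = ((k + 1 : ℕ) : ℕ∞) := by
      rw [← Set.Finite.cast_ncard_eq (Set.finite_Iic k), Set.ncard_eq_toFinset_card']
      simp
    rw [h2] at h1
    have : k + 1 ≤ k := by exact_mod_cast h1
    omega
  · intro i j hij
    have := mul_left_cancel₀ hs0 hij
    have : (i : ℝ) = j := by linarith
    exact_mod_cast this

end Graph

namespace Graph

variable {α β : Type*} {G : Graph α β} {k : ℕ}

/-! ### Facets and cardinalities of intersections -/

/-- The function σ|B ∩ F| is minimal on the facet and not constant, hence affinely equivalent to l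
on the configuration. This turns a bound on the values of a count into a bound on those of l. -/
lemma _root_.IsFacetDefining.encard_image_eq_ncard {l : (E(G) → ℝ) →ᵃ[ℝ] ℝ}
    (hl : IsFacetDefining G.baseConfiguration l) (hE : E(G).Finite) (F : Set β) {σ : ℝ}
    (hσ : σ ≠ 0)
    (hmin : ∀ B₀ B, G.IsSpanningForest B₀ → G.IsSpanningForest B → l (G.charVec B₀) = 0 →
      σ * (B₀ ∩ F).ncard ≤ σ * (B ∩ F).ncard)
    (hnc : ∃ B B', G.IsSpanningForest B ∧ G.IsSpanningForest B' ∧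
      (B ∩ F).ncard ≠ (B' ∩ F).ncard) :
    (l '' G.baseConfiguration).encard =
        ((fun B => (B ∩ F).ncard) '' {B | G.IsSpanningForest B}).encard := by
  obtain ⟨h, hh⟩ := exists_affineMap_eq hE 0 (fun e => σ * F.indicator (1 : β → ℝ) e)
  have hh' : ∀ B, G.IsSpanningForest B → h (G.charVec B) = σ * (B ∩ F).ncard := fun B hB => by
    rw [hh B hB.prop.1, zero_add, ← finsum_indicator_one (hB.prop.finite hE)]
    exact (mul_finsum_mem _ _).symm
  have h1 := hl.encard_image_eq (finite_baseConfiguration hE) (l' := h) (by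
    rintro _ ⟨B₀, hB₀, rfl⟩ hz _ ⟨B, hB, rfl⟩
    rw [hh' _ hB₀, hh' _ hB]
    exact hmin _ _ hB₀ hB hz) (by
    obtain ⟨B, B', hB, hB', hne⟩ := hnc
    refine ⟨_, hB.charVec_mem, _, hB'.charVec_mem, ?_⟩
    rw [hh' _ hB, hh' _ hB']
    exact fun h => hne (by exact_mod_cast mul_left_cancel₀ hσ h))
  rw [← h1.1]
  have h2 : h '' G.baseConfiguration =
      (fun n : ℕ => σ * n) '' ((fun B => (B ∩ F).ncard) '' {B | G.IsSpanningForest B}) := by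
    rw [Set.image_image]
    ext r
    constructor
    · rintro ⟨_, ⟨B, hB, rfl⟩, rfl⟩
      exact ⟨B, hB, (hh' B hB).symm⟩
    · rintro ⟨B, hB, rfl⟩
      exact ⟨_, hB.charVec_mem, hh' B hB⟩
  rw [h2, Function.Injective.encard_image]
  exact fun m n hmn => by exact_mod_cast mul_left_cancel₀ hσ hmn

/-- A spanning forest of minimum weight has as many edges as possible in the set of the lightest
edges. -/
lemma ncard_inter_le_of_minimum_weight (hV : V(G).Finite) (hE : E(G).Finite) {c : β → ℝ}
    {F B₀ B : Set β} (hB₀ : G.IsSpanningForest B₀) (hB : G.IsSpanningForest B)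
    (hmin : ∀ J, G.IsSpanningForest J → ∑ᶠ e ∈ B₀, c e ≤ ∑ᶠ e ∈ J, c e)
    (hF : ∀ e ∈ F, ∀ f ∈ E(G), f ∉ F → c e < c f) : (B ∩ F).ncard ≤ (B₀ ∩ F).ncard := by
  by_contra hlt
  -- Otherwise an edge e of B ∩ F joins two classes of B₀ ∩ F. It can be exchanged for an edge f of
  -- B₀ outside F, which is heavier.
  obtain ⟨e, he, x, y, hl, hxy⟩ : ∃ e ∈ B ∩ F, ∃ x y, G.IsLink e x y ∧
      ¬ G.EdgeConn (B₀ ∩ F) x y := by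
    by_contra! hc
    exact hlt ((hB₀.prop.subset Set.inter_subset_left).ncard_le_ncard
      (hB.prop.subset Set.inter_subset_left) hV hE hc)
  have heB₀ : e ∉ B₀ := fun h => hxy (EdgeConn.of_isLink ⟨h, he.2⟩ hl)
  obtain ⟨J, hIJ, hJX, hJ⟩ := ((hB₀.prop.subset Set.inter_subset_left).insert_edge hl
    hxy).exists_isSpanningForest_of_subset (X := insert e B₀)
    (Set.insert_subset_insert Set.inter_subset_left)
    (fun f a b h => (hB₀.isSpanning f a b h).mono (Set.subset_insert _ _))
    (Set.insert_subset hl.edge_mem hB₀.prop.1) hE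
  have hBfin := hB₀.prop.finite hE
  have hcard := hJ.ncard_eq hB₀ hV hE
  have heJ : e ∈ J := hIJ (Set.mem_insert _ _)
  obtain ⟨f, hfB, hfJ⟩ : ∃ f ∈ B₀, f ∉ J := by
    by_contra! hc
    have := Set.ncard_le_ncard (Set.insert_subset heJ hc) (hJ.prop.finite hE)
    rw [Set.ncard_insert_of_notMem heB₀ hBfin] at this
    omega
  have hfF : f ∉ F := fun h => hfJ (hIJ (.inr ⟨hfB, h⟩))
  have heBf : e ∉ B₀ \ {f} := fun h => heB₀ h.1
  have hJeq : J = insert e (B₀ \ {f}) := by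
    refine Set.eq_of_subset_of_ncard_le ?_ ?_ ((hBfin.subset Set.sdiff_subset).insert e)
    · intro g hg
      obtain rfl | h := hJX hg
      · exact .inl rfl
      · exact .inr ⟨h, fun hgf => hfJ (hgf ▸ hg)⟩
    · rw [Set.ncard_insert_of_notMem heBf (hBfin.subset Set.sdiff_subset),
        Set.ncard_sdiff_singleton_add_one hfB hBfin, hcard]
  have h1 := hmin J hJ
  have h2 := finsum_mem_insert c (a := f) (s := B₀ \ {f}) (by simp) (hBfin.subset Set.sdiff_subset)
  rw [Set.insert_sdiff_singleton, Set.insert_eq_of_mem hfB] at h2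
  rw [hJeq, finsum_mem_insert _ heBf (hBfin.subset Set.sdiff_subset)] at h1
  have := hF e he.2 f (hB₀.prop.1 hfB) hfF
  linarith

lemma finsum_mem_eq_of_ncard_fiber_eq {B B' : Set β} (hB : B.Finite) (hB' : B'.Finite) (c : β → ℝ)
    (h : ∀ t, (B ∩ {e | c e = t}).ncard = (B' ∩ {e | c e = t}).ncard) :
    ∑ᶠ e ∈ B, c e = ∑ᶠ e ∈ B', c e := by
  classical
  let s := (hB.union hB').toFinset.image c
  have key : ∀ D : Set β, ∀ hD : D.Finite, D ⊆ B ∪ B' →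
      ∑ᶠ e ∈ D, c e = ∑ t ∈ s, (D ∩ {e | c e = t}).ncard * t := by
    intro D hD hDs
    rw [finsum_mem_eq_finite_toFinset_sum _ hD, ← Finset.sum_fiberwise_of_maps_to (g := c) (t := s)]
    · refine Finset.sum_congr rfl fun t _ => ?_
      rw [Finset.sum_congr rfl (g := fun _ => t) (fun i hi => (Finset.mem_filter.1 hi).2),
        Finset.sum_const, nsmul_eq_mul]
      congr 2
      rw [← Set.ncard_coe_finset]
      congr 1
      ext e
      simp
    · intro e he
      exact Finset.mem_image_of_mem _ (by simpa using hDs (by simpa using he))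
  rw [key B hB Set.subset_union_left, key B' hB' Set.subset_union_right]
  simp only [h]

/-! ### Sets of edges that define a facet -/

/-- The spanning forests in `Z` have as many edges in `F` as possible, and not all spanning
forests have the same number of edges in `F`. -/
structure IsMaximizedOn (G : Graph α β) (Z : Set (Set β)) (F : Set β) : Prop where
  subset : F ⊆ E(G)
  le : ∀ B₀ ∈ Z, ∀ B, G.IsSpanningForest B → (B ∩ F).ncard ≤ (B₀ ∩ F).ncard
  nonconstant : ∃ B B', G.IsSpanningForest B ∧ G.IsSpanningForest B' ∧
    (B ∩ F).ncard ≠ (B' ∩ F).ncard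

/-- Forests with l = 0 have minimum weight, so they meet every lower level set of the weights as
often as possible. If all these counts were constant, so would be the number of edges of each
weight, and with it l. -/
lemma exists_isMaximizedOn (hV : V(G).Finite) (hE : E(G).Finite) {l : (E(G) → ℝ) →ᵃ[ℝ] ℝ}
    (hl : ∀ v ∈ G.baseConfiguration, 0 ≤ l v)
    (hnc : ∃ v ∈ G.baseConfiguration, ∃ w ∈ G.baseConfiguration, l v ≠ l w) :
    ∃ F, G.IsMaximizedOn {B | G.IsSpanningForest B ∧ l (G.charVec B) = 0} F := by
  obtain ⟨a, c, hac⟩ := exists_eq_add_finsum hE l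
  by_contra! hnone
  have key : ∀ F ⊆ E(G), (∀ e ∈ F, ∀ f ∈ E(G), f ∉ F → c e < c f) →
      ∀ B B', G.IsSpanningForest B → G.IsSpanningForest B' →
      (B ∩ F).ncard = (B' ∩ F).ncard := by
    intro F hFE hF B B' hB hB'
    by_contra hne
    refine hnone F ⟨hFE, ?_, B, B', hB, hB', hne⟩
    rintro B₀ ⟨hB₀, h0⟩ B hB
    refine ncard_inter_le_of_minimum_weight hV hE hB₀ hB (fun J hJ => ?_) hF
    have := hl _ hJ.charVec_mem
    rw [hac _ hJ.prop.1] at this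
    rw [hac _ hB₀.prop.1] at h0
    linarith
  obtain ⟨_, ⟨B, hB, rfl⟩, _, ⟨B', hB', rfl⟩, hne⟩ := hnc
  refine hne ?_
  rw [hac _ hB.prop.1, hac _ hB'.prop.1, finsum_mem_eq_of_ncard_fiber_eq (hB.prop.finite hE)
    (hB'.prop.finite hE) c fun t => ?_]
  -- The edges of weight exactly t are the difference of two lower level sets.
  have h1 := key {e | e ∈ E(G) ∧ c e ≤ t} (fun e he => he.1)
    (fun e he f hf hf' => he.2.trans_lt (not_le.1 fun h => hf' ⟨hf, h⟩)) B B' hB hB'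
  have h2 := key {e | e ∈ E(G) ∧ c e < t} (fun e he => he.1)
    (fun e he f hf hf' => he.2.trans_le (not_lt.1 fun h => hf' ⟨hf, h⟩)) B B' hB hB'
  have h3 : ∀ D ⊆ E(G), (D ∩ {e | e ∈ E(G) ∧ c e ≤ t}).ncard =
      (D ∩ {e | e ∈ E(G) ∧ c e < t}).ncard + (D ∩ {e | c e = t}).ncard := by
    intro D hD
    rw [← Set.ncard_union_eq _ ((hE.subset hD).subset Set.inter_subset_left)
      ((hE.subset hD).subset Set.inter_subset_left)]
    · congr 1
      ext e
      simp only [Set.mem_inter_iff, Set.mem_ofPred_eq, Set.mem_union, le_iff_lt_or_eq]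
      have := @hD e
      tauto
    · exact Set.disjoint_left.2 fun e he he' => he.2.2.ne he'.2
  rw [h3 B hB.prop.1, h3 B' hB'.prop.1] at h1
  omega

/-- A walk that leaves S through edges of J can do so and return only at the one common vertex, so
the detour can be cut out. -/
lemma IsForest.union_of_separated {I J : Set β} {S T : Set α} (hI : G.IsForest I)
    (hJ : G.IsForest J) (hIS : ∀ e ∈ I, ∀ x y, G.IsLink e x y → x ∈ S)
    (hJT : ∀ e ∈ J, ∀ x y, G.IsLink e x y → x ∈ T) (hST : (S ∩ T).Subsingleton) :
    G.IsForest (I ∪ J) := by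
  have key : ∀ (I J : Set β) (S T : Set α), G.IsForest I →
      (∀ e ∈ I, ∀ x y, G.IsLink e x y → x ∈ S) →
      (∀ e ∈ J, ∀ x y, G.IsLink e x y → x ∈ T) → (S ∩ T).Subsingleton →
      ∀ e ∈ I, ∀ x y, G.IsLink e x y → ¬ G.EdgeConn ((I ∪ J) \ {e}) x y := by
    intro I J S T hI hIS hJT hST e he x y hl hc
    refine hI.not_edgeConn he hl ?_
    have : (y ∈ S ∧ G.EdgeConn (I \ {e}) x y) ∨
        (y ∉ S ∧ ∃ u ∈ S ∩ T, G.EdgeConn (I \ {e}) x u) := by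
      have hx := hIS e he x y hl
      clear hl
      induction hc with
      | refl => exact .inl ⟨hx, .refl _⟩
      | @tail z z' _ h ih =>
        obtain ⟨f, ⟨hf | hf, hfe⟩, h⟩ := h
        · obtain ⟨-, ih⟩ | ⟨hz, -⟩ := ih
          · exact .inl ⟨hIS f hf _ _ h.symm, ih.tail ⟨hf, hfe⟩ h⟩
          · exact absurd (hIS f hf _ _ h) hz
        · obtain ⟨u, hu, hxu⟩ : ∃ u ∈ S ∩ T, G.EdgeConn (I \ {e}) x u := by
            obtain ⟨hz, ih⟩ | ⟨-, ih⟩ := ih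
            · exact ⟨z, ⟨hz, hJT f hf _ _ h⟩, ih⟩
            · exact ih
          by_cases hz' : z' ∈ S
          · exact .inl ⟨hz', hST hu ⟨hz', hJT f hf _ _ h.symm⟩ ▸ hxu⟩
          · exact .inr ⟨hz', u, hu, hxu⟩
    exact (this.resolve_right fun h => h.1 (hIS e he _ _ hl.symm)).2
  refine isForest_iff.2 ⟨Set.union_subset hI.1 hJ.1, ?_⟩
  rintro e (he | he)
  · exact key I J S T hI hIS hJT hST e he
  · rw [Set.union_comm]
    exact key J I T S hJ hJT hIS (Set.inter_comm S T ▸ hST) e he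

lemma ncard_inter_union {B F₁ F₂ : Set β} (hB : B.Finite) (h : Disjoint F₁ F₂) :
    (B ∩ (F₁ ∪ F₂)).ncard = (B ∩ F₁).ncard + (B ∩ F₂).ncard := by
  rw [Set.inter_union_distrib_left, Set.ncard_union_eq (h.mono Set.inter_subset_right
    Set.inter_subset_right) (hB.subset Set.inter_subset_left) (hB.subset Set.inter_subset_left)]

/-- Forests in the two parts combine freely, so a forest that is optimal for the union is optimal
for each part. At least one of the two counts is not constant. -/
lemma IsMaximizedOn.of_union (hE : E(G).Finite) {Z : Set (Set β)} {F₁ F₂ : Set β}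
    (hZ : ∀ B ∈ Z, G.IsSpanningForest B) (h : G.IsMaximizedOn Z (F₁ ∪ F₂)) (hd : Disjoint F₁ F₂)
    (hf : ∀ I ⊆ F₁, ∀ J ⊆ F₂, G.IsForest I → G.IsForest J → G.IsForest (I ∪ J)) :
    G.IsMaximizedOn Z F₁ ∨ G.IsMaximizedOn Z F₂ := by
  have hle : ∀ B₀ ∈ Z, ∀ B₁ B₂, G.IsSpanningForest B₁ → G.IsSpanningForest B₂ →
      (B₁ ∩ F₁).ncard + (B₂ ∩ F₂).ncard ≤ (B₀ ∩ F₁).ncard + (B₀ ∩ F₂).ncard := by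
    intro B₀ hB₀ B₁ B₂ hB₁ hB₂
    obtain ⟨B, hsub, hB⟩ := (hf _ Set.inter_subset_right _ Set.inter_subset_right
      (hB₁.prop.subset Set.inter_subset_left)
      (hB₂.prop.subset Set.inter_subset_left)).exists_isSpanningForest hE
    have h1 := h.le B₀ hB₀ B hB
    have hBfin := hB.prop.finite hE
    rw [ncard_inter_union ((hZ B₀ hB₀).prop.finite hE) hd, ncard_inter_union hBfin hd] at h1
    have h2 := Set.ncard_le_ncard (s := B₁ ∩ F₁) (t := B ∩ F₁)
      (fun e he => ⟨hsub (.inl he), he.2⟩) (hBfin.subset Set.inter_subset_left)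
    have h3 := Set.ncard_le_ncard (s := B₂ ∩ F₂) (t := B ∩ F₂)
      (fun e he => ⟨hsub (.inr he), he.2⟩) (hBfin.subset Set.inter_subset_left)
    omega
  obtain ⟨B, B', hB, hB', hne⟩ := h.nonconstant
  rw [ncard_inter_union (hB.prop.finite hE) hd, ncard_inter_union (hB'.prop.finite hE) hd] at hne
  by_cases h1 : (B ∩ F₁).ncard = (B' ∩ F₁).ncard
  · refine .inr ⟨Set.subset_union_right.trans h.subset, fun B₀ hB₀ B hB => ?_,
      B, B', hB, hB', by omega⟩
    have := hle B₀ hB₀ B₀ B (hZ B₀ hB₀) hB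
    omega
  · refine .inl ⟨Set.subset_union_left.trans h.subset, fun B₀ hB₀ B hB => ?_, B, B', hB, hB', h1⟩
    have := hle B₀ hB₀ B B₀ hB (hZ B₀ hB₀)
    omega

/-- The ends of the edges in `F`. -/
def endSet (G : Graph α β) (F : Set β) : Set α := {x | ∃ e ∈ F, G.Inc e x}

/-- If removing D disconnected the ends of F, the edges meeting one component would share only
vertices of D with the other edges. One of the two parts would then contradict minimality. The cases
where D is empty or a single vertex give biconnectedness. -/
lemma connOn_endSet_sdiff_of_minimal (hE : E(G).Finite) {Z : Set (Set β)} {F : Set β}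
    (hZ : ∀ B ∈ Z, G.IsSpanningForest B) (hF : Minimal (G.IsMaximizedOn Z) F) {D : Set α}
    (hD : D.Subsingleton) :
    ConnOn (fun a b => ∃ e ∈ F, G.IsLink e a b) (G.endSet F \ D) := by
  intro x hx y hy
  by_contra hxy
  let K : Set α := {z | Relation.ReflTransGen (fun a b => (∃ e ∈ F, G.IsLink e a b) ∧
    a ∈ G.endSet F \ D ∧ b ∈ G.endSet F \ D) x z}
  have hKS : ∀ z ∈ K, z ∈ G.endSet F \ D := fun z hz => Relation.ReflTransGen.mem_on hz hx
  have hK : ∀ e ∈ F, ∀ a b, G.IsLink e a b → a ∈ K → b ∈ K ∨ b ∈ D := by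
    intro e he a b hl ha
    by_cases hb : b ∈ D
    · exact .inr hb
    · exact .inl (Relation.ReflTransGen.tail ha ⟨⟨e, he, hl⟩, hKS a ha, ⟨e, he, hl.inc_right⟩, hb⟩)
  let F₁ : Set β := {e ∈ F | ∃ a ∈ K, G.Inc e a}
  have hF₁ : F₁ ⊆ F := Set.sep_subset _ _
  have hunion : F₁ ∪ F \ F₁ = F := Set.union_sdiff_cancel hF₁
  have hsep : ∀ I ⊆ F₁, ∀ J ⊆ F \ F₁, G.IsForest I → G.IsForest J → G.IsForest (I ∪ J) := by
    intro I hI J hJ hIf hJf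
    refine hIf.union_of_separated (S := K ∪ D) (T := Kᶜ) hJf (fun e he a b hl => ?_)
      (fun e he a b hl ha => (hJ he).2 ⟨(hJ he).1, a, ha, hl.inc_left⟩) ?_
    · obtain ⟨heF, c, hc, hec⟩ := hI he
      obtain rfl | rfl := hec.eq_or_eq_of_isLink hl
      · exact .inl hc
      · exact hK e heF _ _ hl.symm hc
    · rintro a ⟨ha | ha, ha'⟩ b ⟨hb | hb, hb'⟩
      exacts [absurd ha ha', absurd ha ha', absurd hb hb', hD ha hb]
  obtain ⟨e, he, hex⟩ := hx.1
  obtain ⟨f, hf, b, hfyb⟩ := hy.1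
  have heF₁ : e ∈ F₁ := ⟨he, x, .refl, hex⟩
  have hfF₁ : f ∉ F₁ := by
    rintro ⟨-, a, ha, hfa⟩
    obtain rfl | rfl := hfa.eq_or_eq_of_isLink hfyb
    · exact hxy ha
    · exact (hK f hf _ _ hfyb.symm ha).elim hxy hy.2
  obtain h | h := (hunion.symm ▸ hF.prop : G.IsMaximizedOn Z (F₁ ∪ F \ F₁)).of_union hE hZ
    Set.disjoint_sdiff_right hsep
  · exact hfF₁ (hF.le_of_le h hF₁ hf)
  · exact (hF.le_of_le h Set.sdiff_subset he).2 heF₁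

/-- By the maximality of the count, B₀ ∩ F is a maximal forest inside F, so it has the same classes
as F. -/
lemma IsMaximizedOn.edgeConn (hE : E(G).Finite) {Z : Set (Set β)} {F B₀ : Set β}
    (hF : G.IsMaximizedOn Z F) (hB₀ : B₀ ∈ Z) (hB₀f : G.IsForest B₀) {x y : α}
    (h : G.EdgeConn F x y) : G.EdgeConn (B₀ ∩ F) x y := by
  obtain ⟨J, hIJ, hJF, hJ, hJc⟩ := (hB₀f.subset (Set.inter_subset_left (t := F))).exists_maximal
    Set.inter_subset_right hF.subset hE
  obtain ⟨B, hJB, hB⟩ := hJ.exists_isSpanningForest hE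
  have h1 := Set.ncard_le_ncard (Set.subset_inter hJB hJF)
    ((hB.prop.finite hE).subset Set.inter_subset_left)
  have := Set.eq_of_subset_of_ncard_le hIJ (h1.trans (hF.le B₀ hB₀ B hB)) (hJ.finite hE)
  exact this ▸ hJc x y h

end Graph

namespace Graph

variable {α β : Type*} {G : Graph α β} {k : ℕ} {U W : Set α}

/-! ### Components outside a biconnected set -/

/-- `W` is disjoint from `U` and all neighbours of `W` outside of `W` lie in `U`. -/
structure IsClosedOutside (G : Graph α β) (U W : Set α) : Prop where
  subset : W ⊆ V(G) \ U
  mem : ∀ a ∈ W, ∀ b, G.Adj a b → b ∈ W ∨ b ∈ U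

/-- The edges with an end in `W`. -/
def incEdges (G : Graph α β) (W : Set α) : Set β := {e | ∃ w ∈ W, G.Inc e w}

/-- The vertices in `U` that are adjacent to `W`. -/
def attach (G : Graph α β) (U W : Set α) : Set α := {u ∈ U | ∃ w ∈ W, G.Adj u w}

lemma isClosedOutside_sdiff : G.IsClosedOutside U (V(G) \ U) :=
  ⟨subset_rfl, fun _ _ _ h => or_iff_not_imp_right.2 fun hb => ⟨h.right_mem, hb⟩⟩

/-- A walk that starts in W uses only edges at W until it first reaches U. -/
lemma IsClosedOutside.edgeConn_or (hW : G.IsClosedOutside U W) {B X : Set β}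
    (hX : B ∩ G.incEdges W ⊆ X) {a z : α} (ha : a ∈ W) (h : G.EdgeConn B a z) :
    (z ∈ W ∧ G.EdgeConn X a z) ∨ ∃ u ∈ G.attach U W, G.EdgeConn X a u := by
  induction h with
  | refl => exact .inl ⟨ha, .refl _⟩
  | tail _ h ih =>
    obtain ⟨e, he, hl⟩ := h
    obtain ⟨hz, ih⟩ | ih := ih
    · have h1 := ih.tail (hX ⟨he, _, hz, hl.inc_left⟩) hl
      obtain h2 | h2 := hW.mem _ hz _ ⟨e, hl⟩
      · exact .inl ⟨h2, h1⟩
      · exact .inr ⟨_, ⟨h2, _, hz, e, hl.symm⟩, h1⟩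
    · exact .inr ih

lemma IsClosedOutside.edgeConn_of_isLink (hW : G.IsClosedOutside U W) {B X : Set β}
    (hB : G.IsSpanning B) (hX : B ∩ G.incEdges W ⊆ X)
    (hU : ∀ u ∈ U, ∀ v ∈ U, G.EdgeConn X u v) {e : β} {x y : α} (hx : x ∈ W)
    (hl : G.IsLink e x y) : G.EdgeConn X x y := by
  obtain ⟨-, h⟩ | ⟨u, hu, hxu⟩ := hW.edgeConn_or hX hx (hB e x y hl)
  · exact h
  obtain hy | hy := hW.mem x hx y ⟨e, hl⟩
  · obtain ⟨-, h⟩ | ⟨v, hv, hyv⟩ := hW.edgeConn_or hX hy (hB e y x hl.symm)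
    · exact h.symm
    · exact (hxu.trans (hU u hu.1 v hv.1)).trans hyv.symm
  · exact hxu.trans (hU u hu.1 y hy)

/-- Replacing the edges of B₀ at W by those of B leaves a spanning set, since the remaining edges of
B₀ already connect U. It cannot have fewer edges than B₀. -/
lemma IsClosedOutside.ncard_inter_le (hV : V(G).Finite) (hE : E(G).Finite)
    (hW : G.IsClosedOutside U W) {B₀ B : Set β} (hB₀ : G.IsSpanningForest B₀)
    (hB : G.IsSpanningForest B) (hU : ∀ u ∈ U, ∀ v ∈ U, G.EdgeConn (B₀ \ G.incEdges W) u v) :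
    (B₀ ∩ G.incEdges W).ncard ≤ (B ∩ G.incEdges W).ncard := by
  let X : Set β := B₀ \ G.incEdges W ∪ B ∩ G.incEdges W
  have hXE : X ⊆ E(G) := Set.union_subset (Set.sdiff_subset.trans hB₀.prop.1)
    (Set.inter_subset_left.trans hB.prop.1)
  have hUX : ∀ u ∈ U, ∀ v ∈ U, G.EdgeConn X u v := fun u hu v hv =>
    (hU u hu v hv).mono Set.subset_union_left
  have hW' : G.IsClosedOutside U ((V(G) \ U) \ W) := by
    refine ⟨Set.sdiff_subset, fun a ha b hab => or_iff_not_imp_right.2 fun hb =>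
      ⟨⟨hab.right_mem, hb⟩, fun hbW => ?_⟩⟩
    exact (hW.mem b hbW a hab.symm).elim ha.2 ha.1.2
  have hsub : B₀ ∩ G.incEdges ((V(G) \ U) \ W) ⊆ X := by
    rintro e ⟨he, a, ha, b, hl⟩
    refine .inl ⟨he, ?_⟩
    rintro ⟨w, hw, hew⟩
    obtain rfl | rfl := hew.eq_or_eq_of_isLink hl
    · exact ha.2 hw
    · exact (hW.mem _ hw a ⟨e, hl.symm⟩).elim ha.2 ha.1.2
  have hX : G.IsSpanning X := by
    have key : ∀ e x y, G.IsLink e x y → x ∉ U → G.EdgeConn X x y := by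
      intro e x y hl hx
      by_cases hxW : x ∈ W
      · exact hW.edgeConn_of_isLink hB.isSpanning Set.subset_union_right hUX hxW hl
      · exact hW'.edgeConn_of_isLink hB₀.isSpanning hsub hUX ⟨⟨hl.left_mem, hx⟩, hxW⟩ hl
    intro e x y hl
    by_cases hx : x ∈ U
    · by_cases hy : y ∈ U
      · exact hUX x hx y hy
      · exact (key e y x hl.symm hy).symm
    · exact key e x y hl hx
  obtain ⟨J, -, hJX, hJ⟩ := (IsForest.empty (G := G)).exists_isSpanningForest_of_subset
    (Set.empty_subset X) hX hXE hE
  have h1 := Set.ncard_le_ncard hJX (hE.subset hXE)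
  have h2 := Set.ncard_union_le (B₀ \ G.incEdges W) (B ∩ G.incEdges W)
  have h3 := Set.ncard_inter_add_ncard_sdiff_eq_ncard B₀ (G.incEdges W) (hB₀.prop.finite hE)
  have h4 := hJ.ncard_eq hB₀ hV hE
  have h5 : X.ncard ≤ _ := h2
  omega

/-- If `W` is a connected set of vertices, the number of edges with an end in `W` in a spanning
forest takes at most as many values as there are vertices of attachment (or one, if there are
none). -/
lemma IsClosedOutside.encard_image_le (hV : V(G).Finite) (hE : E(G).Finite) (hU : U ⊆ V(G))
    (hW : G.IsClosedOutside U W) (hne : W.Nonempty) (hc : ConnOn G.Adj W) :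
    ((fun B => (B ∩ G.incEdges W).ncard) '' {B | G.IsSpanningForest B}).encard ≤
      max (G.attach U W).ncard 1 := by
  obtain ⟨w₀, hw₀⟩ := hne
  have hWV : W ⊆ V(G) := hW.subset.trans Set.sdiff_subset
  let Z : Set α := W ∪ G.attach U W
  have hZ : Z.Finite := hV.subset (Set.union_subset hWV fun u hu => hU hu.1)
  have hWc : ∀ B, G.IsSpanningForest B → ∀ x ∈ W, ∀ y ∈ W, G.EdgeConn B x y := by
    intro B hB x hx y hy
    have : G.EdgeConn E(G) x y := by
      refine Relation.ReflTransGen.mono ?_ _ _ (hc x hx y hy)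
      rintro a b ⟨⟨e, he⟩, -⟩
      exact ⟨e, he.edge_mem, he⟩
    exact this.bind fun e _ => hB.isSpanning e
  -- Every class of Z under the forest edges at W contains a vertex of attachment; if there is none,
  -- Z = W is a single class. With R a set of class representatives, the count is |Z| - |R|, where 1
  -- ≤ |R| ≤ |N|.
  obtain ⟨N, hNZ, hNcard, hN⟩ : ∃ N ⊆ Z, N.ncard ≤ max (G.attach U W).ncard 1 ∧
      ∀ B, G.IsSpanningForest B → ∀ z ∈ Z, ∃ r ∈ N, G.EdgeConn (B ∩ G.incEdges W) z r := by
    obtain hempty | ⟨n, hn⟩ := (G.attach U W).eq_empty_or_nonempty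
    · refine ⟨{w₀}, Set.singleton_subset_iff.2 (.inl hw₀), by simp, fun B hB z hz => ⟨w₀, rfl, ?_⟩⟩
      have hzW : z ∈ W := hz.resolve_right (by simp [hempty])
      obtain ⟨-, h⟩ | ⟨u, hu, -⟩ := hW.edgeConn_or subset_rfl hzW (hWc B hB z hzW w₀ hw₀)
      · exact h
      · simp [hempty] at hu
    · refine ⟨G.attach U W, Set.subset_union_right, le_max_left _ _, fun B hB z hz => ?_⟩
      obtain hz | hz := hz
      · obtain ⟨w, hw, e, hl⟩ := hn.2
        have hzn := (hWc B hB z hz w hw).trans (hB.isSpanning e _ _ hl.symm)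
        obtain ⟨hnW, -⟩ | h := hW.edgeConn_or subset_rfl hz hzn
        · exact absurd hn.1 (hW.subset hnW).2
        · exact h
      · exact ⟨z, hz, .refl _⟩
  have hsub : (fun B => (B ∩ G.incEdges W).ncard) '' {B | G.IsSpanningForest B} ⊆
      (fun r => Z.ncard - r) '' Set.Icc 1 (max (G.attach U W).ncard 1) := by
    rintro _ ⟨B, hB, rfl⟩
    obtain ⟨R, hRN, hR⟩ := exists_isTransversal_subset (hZ.subset hNZ) hNZ (hN B hB)
    have hRfin := hZ.subset hR.1
    have h1 := (hB.prop.subset Set.inter_subset_left).ncard_add_ncard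
      ((hB.prop.finite hE).subset Set.inter_subset_left) hZ (by
        rintro e ⟨-, w, hw, hew⟩ x y hl
        obtain rfl | rfl := hew.eq_or_eq_of_isLink hl
        · exact .inl hw
        · obtain h | h := hW.mem _ hw x ⟨e, hl.symm⟩
          exacts [.inl h, .inr ⟨h, _, hw, e, hl⟩]) hR
    have h2 : 0 < R.ncard := by
      obtain ⟨r, hr, -⟩ := hR.2.1 w₀ (.inl hw₀)
      exact (Set.ncard_pos hRfin).2 ⟨r, hr⟩
    have h3 := Set.ncard_le_ncard hRN (hZ.subset hNZ)
    refine ⟨R.ncard, ⟨h2, h3.trans hNcard⟩, ?_⟩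
    change Z.ncard - R.ncard = (B ∩ G.incEdges W).ncard
    omega
  refine (Set.encard_le_encard hsub).trans ((Set.encard_image_le _ _).trans ?_)
  rw [← (Set.finite_Icc _ _).cast_ncard_eq, Set.ncard_eq_toFinset_card']
  simp

/-- Among the sets outside `U` whose incident edges are not met constantly, a minimal one is
connected. -/
lemma IsClosedOutside.exists_connOn (hV : V(G).Finite) (hE : E(G).Finite)
    (hW : G.IsClosedOutside U W)
    (hnc : ∃ B B', G.IsSpanningForest B ∧ G.IsSpanningForest B' ∧
      (B ∩ G.incEdges W).ncard ≠ (B' ∩ G.incEdges W).ncard) :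
    ∃ W', G.IsClosedOutside U W' ∧ W'.Nonempty ∧ ConnOn G.Adj W' ∧
      ∃ B B', G.IsSpanningForest B ∧ G.IsSpanningForest B' ∧
        (B ∩ G.incEdges W').ncard ≠ (B' ∩ G.incEdges W').ncard := by
  have hfin : {W | G.IsClosedOutside U W ∧ ∃ B B', G.IsSpanningForest B ∧ G.IsSpanningForest B' ∧
      (B ∩ G.incEdges W).ncard ≠ (B' ∩ G.incEdges W).ncard}.Finite :=
    hV.finite_subsets.subset fun W hW => hW.1.subset.trans Set.sdiff_subset
  obtain ⟨W', hmin⟩ := hfin.exists_minimal ⟨W, hW, hnc⟩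
  obtain ⟨hW', B, B', hB, hB', hne⟩ := hmin.prop
  refine ⟨W', hW', ?_, ?_, B, B', hB, hB', hne⟩
  · by_contra hempty
    rw [Set.not_nonempty_iff_eq_empty.1 hempty] at hne
    simp [incEdges] at hne
  intro x hx y hy
  by_contra hxy
  -- A component K and its complement in W' are both closed outside U, and no edge meets both. The
  -- counts add up, so one of them is not constant.
  let K : Set α := {z | Relation.ReflTransGen (fun a b => G.Adj a b ∧ a ∈ W' ∧ b ∈ W') x z}
  have hKW : K ⊆ W' := fun z hz => Relation.ReflTransGen.mem_on hz hx
  have hKstep : ∀ a ∈ K, ∀ b ∈ W', G.Adj a b → b ∈ K := fun a ha b hb hab =>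
    Relation.ReflTransGen.tail ha ⟨hab, hKW ha, hb⟩
  have hK : G.IsClosedOutside U K := ⟨hKW.trans hW'.subset, fun a ha b hab =>
    (hW'.mem a (hKW ha) b hab).imp_left fun hb => hKstep a ha b hb hab⟩
  have hL : G.IsClosedOutside U (W' \ K) := ⟨Set.sdiff_subset.trans hW'.subset, fun a ha b hab =>
    (hW'.mem a ha.1 b hab).imp_left fun hb => ⟨hb, fun hbK => ha.2 (hKstep b hbK a ha.1 hab.symm)⟩⟩
  have hunion : G.incEdges W' = G.incEdges K ∪ G.incEdges (W' \ K) := by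
    ext e
    constructor
    · rintro ⟨w, hw, hew⟩
      by_cases hwK : w ∈ K
      exacts [.inl ⟨w, hwK, hew⟩, .inr ⟨w, ⟨hw, hwK⟩, hew⟩]
    · rintro (⟨w, hw, hew⟩ | ⟨w, hw, hew⟩)
      exacts [⟨w, hKW hw, hew⟩, ⟨w, hw.1, hew⟩]
  have hdisj : Disjoint (G.incEdges K) (G.incEdges (W' \ K)) := by
    refine Set.disjoint_left.2 ?_
    rintro e ⟨a, ha, b, hl⟩ ⟨c, hc, hec⟩
    obtain rfl | rfl := hec.eq_or_eq_of_isLink hl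
    · exact hc.2 ha
    · exact hc.2 (hKstep a ha _ hc.1 ⟨e, hl⟩)
  rw [hunion, ncard_inter_union (hB.prop.finite hE) hdisj,
    ncard_inter_union (hB'.prop.finite hE) hdisj] at hne
  by_cases h1 : (B ∩ G.incEdges K).ncard = (B' ∩ G.incEdges K).ncard
  · exact (hmin.le_of_le ⟨hL, B, B', hB, hB', by omega⟩ Set.sdiff_subset hx).2 .refl
  · exact hxy (hmin.le_of_le ⟨hK, B, B', hB, hB', h1⟩ hKW hy)

/-- A graph that is not `k`-level, where `k ≥ 2`, has a minor that is the cone over a minimally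
biconnected graph on `k + 1` vertices. -/
theorem exists_cone_isMinorOf_of_not_isKLevel (hV : V(G).Finite) (hE : E(G).Finite) (hk : 2 ≤ k)
    (h : ¬ G.IsKLevel k) :
    ∃ (α' β' : Type) (H : Graph α' β'),
      V(H).ncard = k + 1 ∧ H.IsMinimallyBiconnected ∧ H.cone.IsMinorOf G := by
  obtain ⟨l, hl, hlk⟩ : ∃ l, IsFacetDefining G.baseConfiguration l ∧
      (k : ℕ∞) < (l '' G.baseConfiguration).encard := by
    simpa [IsKLevel, IsKLevelConfiguration] using h
  have hnc : ∃ v ∈ G.baseConfiguration, ∃ w ∈ G.baseConfiguration, l v ≠ l w := by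
    have h1 : (1 : ℕ∞) < (l '' G.baseConfiguration).encard :=
      lt_of_le_of_lt (by exact_mod_cast (by omega : 1 ≤ k)) hlk
    obtain ⟨_, _, ⟨v, hv, rfl⟩, ⟨w, hw, rfl⟩, hne⟩ := Set.one_lt_encard_iff.1 h1
    exact ⟨v, hv, w, hw, hne⟩
  let Z : Set (Set β) := {B | G.IsSpanningForest B ∧ l (G.charVec B) = 0}
  have hfin : {F | G.IsMaximizedOn Z F}.Finite := hE.finite_subsets.subset fun F hF => hF.subset
  obtain ⟨F, hF⟩ := hfin.exists_minimal (exists_isMaximizedOn hV hE hl.1.1 hnc)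
  have hconn : ∀ D : Set α, D.Subsingleton → ConnOn G.Adj (G.endSet F \ D) := fun D hD =>
    (connOn_endSet_sdiff_of_minimal hE (fun B hB => hB.1) hF hD).map id (fun _ h => h)
      (fun y hy => ⟨y, hy, rfl⟩) fun a _ b _ ⟨e, _, he⟩ => .inr ⟨e, he⟩
  have hFconn : ∀ u ∈ G.endSet F, ∀ v ∈ G.endSet F, G.EdgeConn F u v := fun u hu v hv => by
    have := connOn_endSet_sdiff_of_minimal hE (fun B hB => hB.1) hF Set.subsingleton_empty
      u ⟨hu, Set.notMem_empty u⟩ v ⟨hv, Set.notMem_empty v⟩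
    exact Relation.ReflTransGen.mono (fun a b h => h.1) _ _ this
  have hUV : G.endSet F ⊆ V(G) := by
    rintro x ⟨e, -, he⟩
    exact he.vertex_mem
  have hFW : ∀ W, G.IsClosedOutside (G.endSet F) W → Disjoint F (G.incEdges W) := fun W hW =>
    Set.disjoint_left.2 fun e he ⟨w, hw, hew⟩ => (hW.subset hw).2 ⟨e, he, hew⟩
  have hB₀conn : ∀ B₀ ∈ Z, ∀ u ∈ G.endSet F, ∀ v ∈ G.endSet F, G.EdgeConn (B₀ ∩ F) u v :=
    fun B₀ hB₀ u hu v hv => hF.prop.edgeConn hE hB₀ hB₀.1.prop (hFconn u hu v hv)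
  -- Otherwise some spanning forest uses an edge e outside F with both ends in U. No forest of the
  -- facet contains e, because it already connects the ends of e within F. Thus l has only the two
  -- values of the coordinate at e, contrary to k ≥ 2.
  have hsplit : ∃ B B', G.IsSpanningForest B ∧ G.IsSpanningForest B' ∧
      (B ∩ G.incEdges (V(G) \ G.endSet F)).ncard ≠
        (B' ∩ G.incEdges (V(G) \ G.endSet F)).ncard := by
    by_contra! hconst
    let E₀ : Set β := E(G) \ (F ∪ G.incEdges (V(G) \ G.endSet F))
    have hcount : ∀ B, G.IsSpanningForest B → B.ncard = (B ∩ F).ncard +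
        (B ∩ G.incEdges (V(G) \ G.endSet F)).ncard + (B ∩ E₀).ncard := by
      intro B hB
      rw [← ncard_inter_union (hB.prop.finite hE) (hFW _ isClosedOutside_sdiff),
        ← ncard_inter_union (hB.prop.finite hE) Set.disjoint_sdiff_right]
      congr 1
      refine (Set.inter_eq_left.2 fun e he => ?_).symm
      by_cases heF : e ∈ F ∪ G.incEdges (V(G) \ G.endSet F)
      exacts [.inl heF, .inr ⟨hB.prop.1 he, heF⟩]
    obtain ⟨B, B', hB, hB', hne⟩ := hF.prop.nonconstant
    obtain ⟨B₁, hB₁, e, heB₁, heE₀⟩ : ∃ B, G.IsSpanningForest B ∧ (B ∩ E₀).Nonempty := by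
      by_contra! hempty
      have h1 := hcount B hB
      have h2 := hcount B' hB'
      rw [hempty B hB, Set.ncard_empty] at h1
      rw [hempty B' hB', Set.ncard_empty] at h2
      have := hB.ncard_eq hB' hV hE
      have := hconst B B' hB hB'
      omega
    have heF : e ∉ F := fun h => heE₀.2 (.inl h)
    obtain ⟨x, y, hxy⟩ := exists_isLink_of_mem_edgeSet heE₀.1
    have hend : ∀ x, G.Inc e x → x ∈ G.endSet F := fun x hx => by
      by_contra hxU
      exact heE₀.2 (.inr ⟨x, ⟨hx.vertex_mem, hxU⟩, hx⟩)
    have heB₀ : ∀ B₀ ∈ Z, e ∉ B₀ := fun B₀ hB₀ he =>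
      hB₀.1.prop.not_edgeConn he hxy ((hB₀conn B₀ hB₀ x (hend x hxy.inc_left) y
        (hend y hxy.inc_right)).mono fun f hf => ⟨hf.1, fun hfe => heF (hfe ▸ hf.2)⟩)
    have hle1 : ∀ B : Set β, (B ∩ {e}).ncard ≤ 1 := fun B => by
      rw [Set.inter_comm]
      exact Set.ncard_singleton_inter e B
    obtain ⟨B₀, hB₀⟩ : ∃ B₀, B₀ ∈ Z := by
      obtain ⟨-, _, ⟨B, hB, rfl⟩, h0⟩ := hl.encard_image_eq (l' := l)
        (finite_baseConfiguration hE) (fun v _ hv0 w hw => hv0 ▸ hl.1.1 w hw) hnc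
      exact ⟨B, hB, h0⟩
    have hzero : ∀ B ∈ Z, B ∩ {e} = ∅ := fun B hB =>
      Set.inter_singleton_eq_empty.2 (heB₀ B hB)
    rw [hl.encard_image_eq_ncard hE {e} one_ne_zero (by
      intro B₀ B hB₀ hB h0
      rw [hzero B₀ ⟨hB₀, h0⟩]
      simp) ⟨B₀, B₁, hB₀.1, hB₁, by
        rw [hzero B₀ hB₀, Set.inter_eq_right.2 (Set.singleton_subset_iff.2 heB₁)]
        simp⟩] at hlk
    have h1 : ((fun B => (B ∩ {e}).ncard) '' {B | G.IsSpanningForest B}).encard ≤ 2 := by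
      refine (Set.encard_le_encard (t := {0, 1}) ?_).trans (Set.encard_pair zero_ne_one).le
      rintro _ ⟨B, -, rfl⟩
      have := hle1 B
      simp only [Set.mem_insert_iff, Set.mem_singleton_iff]
      omega
    have h2 : (k : ℕ∞) < 2 := hlk.trans_le h1
    have : k < 2 := by exact_mod_cast h2
    omega
  obtain ⟨W, hW, hWne, hWc, hWnc⟩ := isClosedOutside_sdiff.exists_connOn hV hE hsplit
  -- Forests of the facet connect U by edges of F, none of which meets W, so they have as few edges
  -- at W as possible.
  rw [hl.encard_image_eq_ncard hE (G.incEdges W) one_ne_zero (by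
    intro B₀ B hB₀ hB h0
    rw [one_mul, one_mul]
    have h1 := hW.ncard_inter_le hV hE hB₀ hB fun u hu v hv =>
      (hB₀conn B₀ ⟨hB₀, h0⟩ u hu v hv).mono fun e he =>
        ⟨he.1, Set.disjoint_left.1 (hFW W hW) he.2⟩
    exact_mod_cast h1) hWnc] at hlk
  have hcard := hlk.trans_le (hW.encard_image_le hV hE hUV hWne hWc)
  have hcard' : k < max (G.attach (G.endSet F) W).ncard 1 := by exact_mod_cast hcard
  refine exists_cone_isMinorOf hV hUV (hW.subset.trans Set.sdiff_subset)
    (Set.disjoint_left.2 fun x hx hxW => (hW.subset hxW).2 hx) (by omega) ?_ hWc (k := k) ?_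
  · have h0 := hconn ∅ Set.subsingleton_empty
    rw [Set.sdiff_empty] at h0
    exact ⟨h0, fun v _ => hconn {v} Set.subsingleton_singleton⟩
  · change k + 1 ≤ (G.attach (G.endSet F) W).ncard
    omega

/-- A graph without parallel edges that is not `1`-level has a triangle as a minor. -/
theorem exists_cone_isMinorOf_of_not_isKLevel_one (hV : V(G).Finite) (hE : E(G).Finite)
    (hG : G.HasNoParallelEdges) (h : ¬ G.IsKLevel 1) :
    ∃ (α' β' : Type) (H : Graph α' β'),
      V(H).ncard = 1 + 1 ∧ H.IsMinimallyBiconnected ∧ H.cone.IsMinorOf G := by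
  obtain ⟨l, hl, hlk⟩ : ∃ l, IsFacetDefining G.baseConfiguration l ∧
      ((1 : ℕ) : ℕ∞) < (l '' G.baseConfiguration).encard := by
    simpa [IsKLevel, IsKLevelConfiguration] using h
  obtain ⟨_, _, ⟨_, ⟨B, hB, rfl⟩, rfl⟩, ⟨_, ⟨B', hB', rfl⟩, rfl⟩, hne⟩ :=
    Set.one_lt_encard_iff.1 (by simpa using hlk)
  obtain ⟨e, heB, heB'⟩ : ∃ e ∈ B, e ∉ B' := by
    by_contra! hsub
    exact hne (by rw [Set.eq_of_subset_of_ncard_le hsub (hB'.ncard_eq hB hV hE).le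
      (hB'.prop.finite hE)])
  obtain ⟨x, y, hl⟩ := exists_isLink_of_mem_edgeSet (hB.prop.1 heB)
  have hxy : x ≠ y := hB.prop.ne_of_isLink heB hl
  have hconn := hB'.isSpanning e x y hl
  let r : α → α → Prop := fun a b => G.Adj a b ∧ a ∈ V(G) \ {x, y} ∧ b ∈ V(G) \ {x, y}
  obtain ⟨w, hw, hxw, w', hww', hw'y⟩ : ∃ w ∈ V(G) \ {x, y}, G.Adj x w ∧ ∃ w',
      Relation.ReflTransGen r w w' ∧ G.Adj w' y := by
    -- Along the walk in B', either the current vertex is x, or the part since the last visit to x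
    -- avoids y, or a passage from x to y through other vertices has been found. A direct step from
    -- x to y would be an edge parallel to e.
    have key : ∀ z, G.EdgeConn B' x z → z = x ∨
        (∃ w ∈ V(G) \ {x, y}, G.Adj x w ∧ Relation.ReflTransGen r w z) ∨
        ∃ w ∈ V(G) \ {x, y}, G.Adj x w ∧ ∃ w', Relation.ReflTransGen r w w' ∧ G.Adj w' y := by
      intro z hz
      induction hz with
      | refl => exact .inl rfl
      | @tail z z' _ h ih =>
        obtain ⟨f, hf, hlf⟩ := h
        by_cases hz'x : z' = x
        · exact .inl hz'x
        obtain rfl | ⟨w, hw, hxw, hwz⟩ | h3 := ih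
        · by_cases hz'y : z' = y
          · subst hz'y
            exact absurd (hG f e z z' hxy hlf hl ▸ hf) heB'
          · exact .inr (.inl ⟨z', ⟨hlf.right_mem, by simp [hz'x, hz'y]⟩, ⟨f, hlf⟩, .refl⟩)
        · by_cases hz'y : z' = y
          · subst hz'y
            exact .inr (.inr ⟨w, hw, hxw, z, hwz, f, hlf⟩)
          · exact .inr (.inl ⟨w, hw, hxw, hwz.tail ⟨⟨f, hlf⟩, hwz.mem_on hw, hlf.right_mem,
              by simp [hz'x, hz'y]⟩⟩)
        · exact .inr (.inr h3)
    obtain h1 | ⟨w, hw, -, hwy⟩ | h3 := key y hconn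
    · exact absurd h1.symm hxy
    · exact absurd (.inr rfl) (hwy.mem_on hw).2
    · exact h3
  -- The component of w away from x and y is adjacent to both, so it serves as the apex over the
  -- edge e.
  let W : Set α := {z | Relation.ReflTransGen r w z}
  have hWV : W ⊆ V(G) \ {x, y} := fun z hz => Relation.ReflTransGen.mem_on hz hw
  have hxy' : G.Adj x y := ⟨e, hl⟩
  have hbi : BiconnOn G.Adj {x, y} := by
    refine ⟨connOn_of_root (fun _ _ h => h.symm) x ?_, fun v hv => ?_⟩
    · rintro z (rfl | rfl)
      · exact .refl
      · exact .single ⟨hxy', .inl rfl, .inr rfl⟩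
    · refine connOn_of_subsingleton ?_
      rintro a ⟨ha, hav⟩ b ⟨hb, hbv⟩
      obtain rfl | rfl := hv <;> obtain rfl | rfl := ha <;> obtain rfl | rfl := hb <;> simp_all
  refine exists_cone_isMinorOf hV (U := {x, y}) (W := W) ?_ (hWV.trans Set.sdiff_subset)
    (Set.disjoint_left.2 fun z hz hzW => (hWV hzW).2 hz) le_rfl hbi ?_ ?_
  · rintro z (rfl | rfl)
    exacts [hl.left_mem, hl.right_mem]
  · refine connOn_of_root (fun _ _ h => h.symm) w fun z hz => ?_
    induction hz with
    | refl => exact .refl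
    | tail h1 h2 ih => exact ih.tail ⟨h2.1, h1, h1.tail h2⟩
  · have : {u ∈ ({x, y} : Set α) | ∃ w ∈ W, G.Adj u w} = {x, y} := by
      refine Set.sep_eq_self_iff_mem_true.2 ?_
      rintro z (rfl | rfl)
      exacts [⟨w, .refl, hxw⟩, ⟨w', hww', hw'y.symm⟩]
    rw [this, Set.ncard_pair hxy]

end Graph

/-! ### The characterization of k-level graphs -/

theorem mainTheorem3 {α β : Type*} (G : Graph α β) (hV : V(G).Finite) (hE : E(G).Finite)
    (k : ℕ) (hk : 2 ≤ k ∨ (k = 1 ∧ G.HasNoParallelEdges)) :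
    G.IsKLevel k ↔
      ¬ ∃ (α' β' : Type) (H : Graph α' β'),
        V(H).ncard = k + 1 ∧ H.IsMinimallyBiconnected ∧ H.cone.IsMinorOf G := by
  obtain hk2 | ⟨rfl, hG⟩ := hk
  · refine ⟨fun h ⟨α', β', H, hHk, hH, hmin⟩ => ?_, fun h => ?_⟩
    · exact Graph.not_isKLevel_of_cone_isMinorOf hV hE (by omega) hH hHk hmin h
    · by_contra hc
      exact h (Graph.exists_cone_isMinorOf_of_not_isKLevel hV hE hk2 hc)
  · refine ⟨fun h ⟨α', β', H, hHk, hH, hmin⟩ => ?_, fun h => ?_⟩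
    · exact Graph.not_isKLevel_of_cone_isMinorOf hV hE le_rfl hH hHk hmin h
    · by_contra hc
      exact h (Graph.exists_cone_isMinorOf_of_not_isKLevel_one hV hE hG hc)
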